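/- Let $f\in\mathbf C[[x]][y]$ be a distinguished polynomial of degree $n\ge 2$ (that is, monic in $y$ with $f(0,y)=y^n$), and assume that $f$ is reduced (squarefree). Let $K=\mathbf C((x))$, let $\overline K=\bigcup_{d\ge1}\mathbf C((x^{1/d}))$ be the field of Puiseux series with its valuation $\nu:\overline K\to\mathbf Q\cup\{+\infty\}$ in $x$, and let $a_1,\dots,a_n\in\overline K$ be the (distinct) roots of $f$, so that $f=\prod_{i=1}^n(y-a_i)$. For $r\in\mathbf Q$ let $$\mathcal E_r=\Big\{w\in K[y]\ :\ \deg_y w<n,\ \ \nu\Big(\frac{w(x,a_i)}{f'_y(x,a_i)}\Big)\ge r\ \text{ for } 1\le i\le n\Big\},\qquad \mathcal F_r=\{w\in\mathcal E_r\ :\ \deg_y w<n-1\}.$$ (The quotients $w(x,a_i)/f'_y(x,a_i)$ are the coordinates of $w$ in the basis $\varepsilon_i=\prod_{j\ne i}(y-a_j)$.) Put $m_{i,j}=\nu(a_i-a_j)$ for $i\neq j$, $m_i=\sum_{j\ne i}m_{i,j}$, and $$\pi=\sup_{i\ne j}(m_i+m_{i,j}),\qquad \delta=\inf_i\nu(a_i),\qquad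 \theta=\pi-1,\qquad \tau=\pi-\delta .$$ (i) For every $r\in\mathbf Q$, $$\mathcal E_r\subset\mathcal F_{r-\theta}\,f'_x+\mathcal F_{r-\tau}\,f'_y .$$ In particular, $\mathcal E_\pi$ is contained in the Jacobian ideal $(f'_x,f'_y)\,\mathbf C[[x]][y]$. (ii) If $w=uf'_x+vf'_y\in\mathcal E_\pi$ with $u\in\mathcal F_1$ and $v\in\mathcal F_\delta$, then $u'_x+v'_y\in\mathcal F_0$. -/

import Mathlib

open Polynomial
open scoped PowerSeries LaurentSeries

noncomputable section

namespace PlaneCurve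

/-- The field embedding `ℂ((t)) → ℂ((x^ℚ))` (Hahn series), `t ↦ x^(1/d)`. -/
def ramify (d : ℕ+) : ℂ⸨X⸩ →+* HahnSeries ℚ ℂ :=
  HahnSeries.embDomainRingHom
    ((AddMonoidHom.mulRight ((d : ℚ)⁻¹)).comp (Int.castAddHom ℚ))
    (fun a b h => by
      have hd : ((d : ℚ)⁻¹) ≠ 0 := inv_ne_zero (by exact_mod_cast d.ne_zero)
      simpa [hd] using h)
    (fun a b => by
      have hd : (0 : ℚ) < (d : ℚ)⁻¹ := inv_pos.mpr (by exact_mod_cast d.pos)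
      simp [mul_le_mul_iff_left₀ hd])

/-- The field of Puiseux series over `ℂ`: the union over `d ≥ 1` of the fields `ℂ((x^(1/d)))`,
as a subfield of the field of Hahn series with rational exponents. -/
def Puiseux : Subfield (HahnSeries ℚ ℂ) :=
  ⨆ d : ℕ+, (ramify d).fieldRange

theorem ramify_fieldRange_le (d e : ℕ+) :
    (ramify d).fieldRange ≤ (ramify (d * e)).fieldRange := by
  rintro _ ⟨s, rfl⟩
  have he : (0 : ℤ) < (e : ℤ) := by exact_mod_cast e.pos
  refine ⟨HahnSeries.embDomainRingHom (AddMonoidHom.mulRight (e : ℤ))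
    (fun a b h => mul_right_cancel₀ he.ne' (by simpa using h))
    (fun a b => by simp) s, ?_⟩
  ext q
  have hd0 : (d : ℚ) ≠ 0 := by exact_mod_cast d.ne_zero
  have he0 : (e : ℚ) ≠ 0 := by exact_mod_cast e.ne_zero
  by_cases hq : ∃ k : ℤ, q = (k : ℚ) * (d : ℚ)⁻¹
  · obtain ⟨k, rfl⟩ := hq
    have h1 : (ramify d s).coeff ((k : ℚ) * (d : ℚ)⁻¹) = s.coeff k :=
      HahnSeries.embDomain_coeff
    rw [h1]
    have h2 : (k : ℚ) * (d : ℚ)⁻¹ = ((k * (e : ℤ) : ℤ) : ℚ) * (((d * e : ℕ+) : ℕ) : ℚ)⁻¹ := by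
      push_cast
      field_simp
    rw [h2]
    refine Eq.trans (HahnSeries.embDomain_coeff (a := k * (e : ℤ))) ?_
    exact HahnSeries.embDomain_coeff (a := k)
  · have h1 : (ramify d s).coeff q = 0 := by
      refine HahnSeries.embDomain_of_notMem_range ?_
      rintro ⟨k, hk⟩
      exact hq ⟨k, hk.symm⟩
    rw [h1]
    by_contra hne
    obtain ⟨m, hm, hmq⟩ := HahnSeries.support_embDomain_subset (HahnSeries.mem_support _ _ |>.2 hne)
    obtain ⟨k, hk, hkm⟩ := HahnSeries.support_embDomain_subset hm
    refine hq ⟨k, ?_⟩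
    subst hkm
    rw [← hmq]
    change ((k * (e : ℤ) : ℤ) : ℚ) * (((d * e : ℕ+) : ℕ) : ℚ)⁻¹ = _
    push_cast
    field_simp

/-- A Hahn series is a Puiseux series iff it is a Laurent series in `x^(1/d)` for some `d ≥ 1`. -/
theorem mem_Puiseux {s : HahnSeries ℚ ℂ} :
    s ∈ Puiseux ↔ ∃ (d : ℕ+) (g : ℂ⸨X⸩), ramify d g = s := by
  unfold Puiseux
  rw [Subfield.mem_iSup_of_directed]
  · simp [RingHom.mem_fieldRange]
  · intro d e
    refine ⟨d * e, ramify_fieldRange_le d e, ?_⟩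
    rw [mul_comm]
    exact ramify_fieldRange_le e d

/-- The inclusion of `ℂ((x))` in the field of Puiseux series. -/
def toPuiseux : ℂ⸨X⸩ →+* Puiseux :=
  (ramify 1).codRestrict Puiseux (fun g => mem_Puiseux.2 ⟨1, g, rfl⟩)

/-- The valuation in `x` of a Puiseux series, with `ν 0 = ⊤`. -/
def ν (a : Puiseux) : WithTop ℚ := (a : HahnSeries ℚ ℂ).orderTop

/-- The rational-valued valuation, used for nonzero series (its value at `0` is `0`). -/
def νQ (a : Puiseux) : ℚ := (ν a).untopD 0

open scoped Classical in
/-- The set of roots of a polynomial of `ℂ((x))[y]` in the field of Puiseux series. -/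
def branches (f : ℂ⸨X⸩[X]) : Finset Puiseux := (f.map toPuiseux).roots.toFinset

/-- The value `w(x, a)` of `w ∈ ℂ((x))[y]` at `y = a`. -/
def valueAt (w : ℂ⸨X⸩[X]) (a : Puiseux) : Puiseux := w.eval₂ toPuiseux a

/-- `E f r`: polynomials `w ∈ ℂ((x))[y]` of degree `< n = deg f` whose coordinates
`w(x, a) / f'_y(x, a)` in the Lagrange basis `ε_a = f / (y - a)` (`a` running over the roots
of `f`) all have valuation at least `r`. -/
def E (f : ℂ⸨X⸩[X]) (r : ℚ) : Set ℂ⸨X⸩[X] :=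
  {w | w.degree < (f.natDegree : WithBot ℕ) ∧
    ∀ a ∈ branches f, (r : WithTop ℚ) ≤ ν (valueAt w a / valueAt (derivative f) a)}

/-- `F f r`: the elements of `E f r` of degree `< n - 1`. -/
def F (f : ℂ⸨X⸩[X]) (r : ℚ) : Set ℂ⸨X⸩[X] :=
  {w | w ∈ E f r ∧ w.degree < ((f.natDegree - 1 : ℕ) : WithBot ℕ)}

/-- The intersection multiplicity `ν (a - b)` of two distinct branches. -/
def interMult (a b : Puiseux) : ℚ := νQ (a - b)

open scoped Classical in
/-- The sum of the intersection multiplicities of the branch `a` with the other branches. -/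
def totalMult (f : ℂ⸨X⸩[X]) (a : Puiseux) : ℚ :=
  ∑ b ∈ (branches f).erase a, interMult a b

open scoped Classical in
/-- The maximum of `m_a + m_{a,b}` over pairs of distinct branches `a ≠ b`. -/
def piInv (f : ℂ⸨X⸩[X]) : ℚ :=
  ((branches f).offDiag.image (fun p => totalMult f p.1 + interMult p.1 p.2)).max.unbotD 0

/-- The minimum of the valuations of the branches. -/
def deltaInv (f : ℂ⸨X⸩[X]) : ℚ := ((branches f).inf ν).untopD 0

def thetaInv (f : ℂ⸨X⸩[X]) : ℚ := piInv f - 1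

def tauInv (f : ℂ⸨X⸩[X]) : ℚ := piInv f - deltaInv f

/-- The coefficientwise action of an additive map `D` on polynomials in `y`; for `D = d/dx`
this is the partial derivative with respect to `x`. -/
def mapCoeffs {A : Type*} [Semiring A] (D : A →+ A) (p : A[X]) : A[X] :=
  p.sum fun k c => monomial k (D c)

/-- `∂/∂x` on `ℂ[[x]][y]`. -/
def dxP (p : ℂ⟦X⟧[X]) : ℂ⟦X⟧[X] :=
  mapCoeffs (PowerSeries.derivative ℂ : Derivation ℂ ℂ⟦X⟧ ℂ⟦X⟧).toLinearMap.toAddMonoidHom p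

/-- `∂/∂x` on `ℂ((x))[y]`. -/
def dxL (p : ℂ⸨X⸩[X]) : ℂ⸨X⸩[X] :=
  mapCoeffs (LaurentSeries.derivative ℂ : ℂ⸨X⸩ →ₗ[ℂ] ℂ⸨X⸩).toAddMonoidHom p

/-- The inclusion `ℂ[[x]][y] → ℂ((x))[y]`. -/
def toL (p : ℂ⟦X⟧[X]) : ℂ⸨X⸩[X] := p.map (algebraMap ℂ⟦X⟧ ℂ⸨X⸩)

/-- The Jacobian ideal `(f'_x, f'_y)` of `ℂ[[x]][y]`. -/
def jacobianIdeal (f : ℂ⟦X⟧[X]) : Ideal ℂ⟦X⟧[X] := Ideal.span {dxP f, derivative f}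

end PlaneCurve

end

/-! Let `U_a`, `V_a`, `W_a` be the coordinates of `u`, `v`, `w` at a root `a`, put `N_a = f'_y(x,
a)`, and let `'` be `d/dx`. Since `f(x, a(x)) = 0`, one has `f'_x(x, a) = -N_a a'`, so evaluating `w
= u f'_x + v f'_y` at `a` gives `V_a = W_a / N_a + U_a a'`. Feeding this into the `y`-derivative of
the same relation eliminates the `V_a` and leaves (`laplacian_eq`) `∑_{b ≠ a} (a - b)' / (a - b) *
(U_a - U_b) = ` an expression in the `W`'s of order at least `r - π`.

After multiplication by `x`, the weight `x (a - b)' / (a - b)` is `m_{a,b}` plus terms of positive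
order, and `m_{a,b} > 0` because `f` is distinguished. The leading coefficients of the `U_a` are
thus governed by the Laplacian of a complete graph with positive weights. Its kernel consists of the
constants, and `∑ U_a = 0` because `deg u < n - 1`; hence no `U_a` has order below `r - π + 1`
(`le_orderTop_of_laplacian`). The bound on `V_a` follows from the formula for `V_a`.

These bounds also give existence. For `w = 0` they hold for every `r`, so `(u, v) ↦ u f'_x + v f'_y`
is injective on pairs of degree `< n - 1`; by dimension it is onto the polynomials of degree `< 2 (n
- 1)`, and `n ≤ 2 (n - 1)`.

For the divergence, `w / f^2 = (u'_x + v'_y) / f - ∂_x (u / f) - ∂_y (v / f)`. Residues at `y = a`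
express the coordinate of `u'_x + v'_y` as `(U_a)'` plus the residue of `w / f^2`, of order at least
`r - π` (`divergence_div_eq`).

That `f` has `n` distinct Puiseux roots rests on the Newton–Puiseux theorem, proved here from
Weierstrass preparation. -/

noncomputable section

namespace PlaneCurve

/-! ### Differentiation of Hahn series with rational exponents -/

/-- The Euler operator `x d/dx` on Hahn series with rational exponents. -/
def eulerHom : HahnSeries ℚ ℂ →+ HahnSeries ℚ ℂ where
  toFun a :=
    { coeff := fun q => (q : ℂ) * a.coeff q
      isPWO_support' := a.isPWO_support.mono fun q hq h => hq (by simp [h]) }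
  map_zero' := by ext q; simp
  map_add' a b := by ext q; simp [mul_add]

theorem coeff_eulerHom (a : HahnSeries ℚ ℂ) (q : ℚ) :
    (eulerHom a).coeff q = (q : ℂ) * a.coeff q := rfl

theorem support_eulerHom_subset (a : HahnSeries ℚ ℂ) :
    (eulerHom a).support ⊆ a.support := fun q hq h => hq (by simp [coeff_eulerHom, h])

theorem eulerHom_mul (a b : HahnSeries ℚ ℂ) :
    eulerHom (a * b) = a * eulerHom b + b * eulerHom a := by
  ext q
  -- All three sums are taken over the antidiagonal of the supports of `a` and `b`; the rule then
  -- reduces to `q = p.1 + p.2`.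
  rw [mul_comm b, coeff_eulerHom, HahnSeries.coeff_mul, HahnSeries.coeff_add,
    HahnSeries.coeff_mul_right' b.isPWO_support (support_eulerHom_subset b),
    HahnSeries.coeff_mul_left' a.isPWO_support (support_eulerHom_subset a),
    Finset.mul_sum, ← Finset.sum_add_distrib]
  refine Finset.sum_congr rfl fun p hp => ?_
  have h : p.1 + p.2 = q := by simpa using (Finset.mem_antidiagonal.1 hp).2.2
  rw [coeff_eulerHom, coeff_eulerHom, ← h]
  push_cast
  ring

/-- Differentiation `d/dx` of Hahn series with rational exponents. -/
def hahnD : HahnSeries ℚ ℂ →+ HahnSeries ℚ ℂ :=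
  (AddMonoidHom.mulLeft (HahnSeries.single (-1 : ℚ) (1 : ℂ))).comp eulerHom

theorem hahnD_apply (a : HahnSeries ℚ ℂ) :
    hahnD a = HahnSeries.single (-1 : ℚ) (1 : ℂ) * eulerHom a := rfl

theorem hahnD_mul (a b : HahnSeries ℚ ℂ) : hahnD (a * b) = a * hahnD b + b * hahnD a := by
  rw [hahnD_apply, hahnD_apply, hahnD_apply, eulerHom_mul]
  ring

theorem coeff_hahnD (a : HahnSeries ℚ ℂ) (q : ℚ) :
    (hahnD a).coeff q = ((q + 1 : ℚ) : ℂ) * a.coeff (q + 1) := by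
  rw [hahnD_apply, HahnSeries.coeff_single_mul, one_mul, coeff_eulerHom, sub_neg_eq_add]

theorem single_mul_hahnD (a : HahnSeries ℚ ℂ) :
    HahnSeries.single (1 : ℚ) (1 : ℂ) * hahnD a = eulerHom a := by
  rw [hahnD_apply, ← mul_assoc, HahnSeries.single_mul_single]
  simp

/-- Differentiation lowers the order by at most one. -/
theorem le_orderTop_hahnD {a : HahnSeries ℚ ℂ} {r : ℚ} (h : (r : WithTop ℚ) ≤ a.orderTop) :
    ((r - 1 : ℚ) : WithTop ℚ) ≤ (hahnD a).orderTop := by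
  rw [HahnSeries.le_orderTop_iff_forall]
  intro q hq
  rw [coeff_hahnD, HahnSeries.coeff_eq_zero_of_lt_orderTop, mul_zero]
  exact lt_of_lt_of_le (WithTop.coe_lt_coe.2 (by linarith [WithTop.coe_lt_coe.1 hq])) h

/-- `x b' = m b` plus terms of order `> m`, for `m = ν b`. -/
theorem lt_orderTop_eulerHom_sub {b : HahnSeries ℚ ℂ} {m : ℚ} (hm : b.orderTop = m) :
    (m : WithTop ℚ) < (eulerHom b - HahnSeries.C (m : ℂ) * b).orderTop := by
  have hc : ∀ q : ℚ, (eulerHom b - HahnSeries.C (m : ℂ) * b).coeff q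
      = ((q : ℂ) - m) * b.coeff q := fun q => by
    rw [HahnSeries.coeff_sub, coeff_eulerHom, HahnSeries.C_mul_eq_smul, HahnSeries.coeff_smul,
      smul_eq_mul, sub_mul]
  refine lt_of_le_of_ne ?_ (Ne.symm (HahnSeries.orderTop_ne_of_coeff_eq_zero ?_))
  · rw [HahnSeries.le_orderTop_iff_forall]
    intro q hq
    rw [hc, HahnSeries.coeff_eq_zero_of_lt_orderTop (hm ▸ hq), mul_zero]
  · rw [hc, sub_self, zero_mul]

theorem coeff_ramify_mul_inv (d : ℕ+) (g : ℂ⸨X⸩) (k : ℤ) :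
    (ramify d g).coeff ((k : ℚ) * (d : ℚ)⁻¹) = g.coeff k :=
  HahnSeries.embDomain_coeff

theorem coeff_ramify_eq_zero (d : ℕ+) (g : ℂ⸨X⸩) {q : ℚ}
    (hq : ∀ k : ℤ, (k : ℚ) * (d : ℚ)⁻¹ ≠ q) : (ramify d g).coeff q = 0 := by
  refine HahnSeries.embDomain_of_notMem_range ?_
  rintro ⟨k, hk⟩
  exact hq k hk

theorem hahnD_ramify_one (g : ℂ⸨X⸩) :
    hahnD (ramify 1 g) = ramify 1 (LaurentSeries.derivative ℂ g) := by
  ext q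
  rw [coeff_hahnD]
  by_cases hq : ∃ k : ℤ, (k : ℚ) = q
  · obtain ⟨k, rfl⟩ := hq
    have h1 := coeff_ramify_mul_inv 1 (LaurentSeries.derivative ℂ g) k
    have h2 := coeff_ramify_mul_inv 1 g (k + 1)
    simp only [PNat.one_coe, Nat.cast_one, inv_one, mul_one, Int.cast_add, Int.cast_one] at h1 h2
    rw [h1, h2, LaurentSeries.derivative_apply, LaurentSeries.hasseDeriv_coeff]
    simp
  · push Not at hq
    rw [coeff_ramify_eq_zero, coeff_ramify_eq_zero, mul_zero]
    · intro k hk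
      exact hq k (by simpa using hk)
    · intro k hk
      refine hq (k - 1) ?_
      simp at hk
      push_cast
      linarith

theorem orderTop_ramify_one (g : ℂ⸨X⸩) {r : ℤ} :
    ((r : ℚ) : WithTop ℚ) ≤ (ramify 1 g).orderTop ↔ (r : WithTop ℤ) ≤ g.orderTop := by
  rw [HahnSeries.le_orderTop_iff_forall, HahnSeries.le_orderTop_iff_forall]
  constructor
  · intro h j hj
    have := h j (WithTop.coe_lt_coe.2 (by exact_mod_cast hj))
    have h1 := coeff_ramify_mul_inv 1 g j
    simp only [PNat.one_coe, Nat.cast_one, inv_one, mul_one] at h1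
    rw [← h1, this]
  · intro h q hq
    by_cases hq' : ∃ k : ℤ, (k : ℚ) = q
    · obtain ⟨k, rfl⟩ := hq'
      have h1 := coeff_ramify_mul_inv 1 g k
      simp only [PNat.one_coe, Nat.cast_one, inv_one, mul_one] at h1
      rw [h1]
      exact h k (WithTop.coe_lt_coe.2 (by exact_mod_cast hq))
    · push Not at hq'
      exact coeff_ramify_eq_zero 1 g fun k hk => hq' k (by simpa using hk)

/-! ### Derivations acting on the coefficients of a polynomial -/

section MapCoeffs

variable {A B : Type*} [CommRing A] [CommRing B]

theorem coeff_mapCoeffs (D : A →+ A) (p : A[X]) (k : ℕ) :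
    (mapCoeffs D p).coeff k = D (p.coeff k) := by
  unfold mapCoeffs
  rw [Polynomial.sum_def, finsetSum_coeff]
  simp only [coeff_monomial]
  rw [Finset.sum_ite_eq' p.support k]
  split_ifs with h
  · rfl
  · rw [notMem_support_iff.1 h, map_zero]

theorem mapCoeffs_add (D : A →+ A) (p q : A[X]) :
    mapCoeffs D (p + q) = mapCoeffs D p + mapCoeffs D q := by
  ext k; simp [coeff_mapCoeffs]

theorem mapCoeffs_monomial (D : A →+ A) (n : ℕ) (c : A) :
    mapCoeffs D (monomial n c) = monomial n (D c) := by
  ext k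
  rw [coeff_mapCoeffs, coeff_monomial, coeff_monomial]
  split_ifs <;> simp

theorem derivative_mapCoeffs (D : A →+ A) (p : A[X]) :
    derivative (mapCoeffs D p) = mapCoeffs D (derivative p) := by
  ext k
  rw [coeff_mapCoeffs, coeff_derivative, coeff_derivative, coeff_mapCoeffs, mul_comm,
    mul_comm (p.coeff _)]
  have := map_nsmul D (k + 1) (p.coeff (k + 1))
  simpa [nsmul_eq_mul] using this.symm

theorem map_mapCoeffs {D : A →+ A} {D' : B →+ B} {φ : A →+* B}
    (h : ∀ a, D' (φ a) = φ (D a)) (p : A[X]) :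
    (mapCoeffs D p).map φ = mapCoeffs D' (p.map φ) := by
  ext k; simp [coeff_mapCoeffs, h]

theorem degree_mapCoeffs_le (D : A →+ A) (p : A[X]) : (mapCoeffs D p).degree ≤ p.degree := by
  rw [degree_le_iff_coeff_zero]
  intro k hk
  rw [coeff_mapCoeffs, coeff_eq_zero_of_degree_lt hk, map_zero]

variable {D : A →+ A} (hD : ∀ a b, D (a * b) = a * D b + b * D a)
include hD

theorem leibniz_one : D 1 = 0 := by simpa using hD 1 1

theorem leibniz_pow (a : A) (n : ℕ) : D (a ^ n) = n * a ^ (n - 1) * D a := by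
  induction n with
  | zero => simpa using leibniz_one hD
  | succ n ih =>
    rw [pow_succ, hD, ih]
    rcases n with _ | n
    · simp
    · push_cast
      ring

/-- The chain rule for `x ↦ p(x, a(x))`. -/
theorem leibniz_eval (p : A[X]) (a : A) :
    D (p.eval a) = (mapCoeffs D p).eval a + (derivative p).eval a * D a := by
  induction p using Polynomial.induction_on' with
  | add p q hp hq => simp only [eval_add, map_add, mapCoeffs_add, hp, hq, add_mul]; ring
  | monomial n c =>
    rw [mapCoeffs_monomial, derivative_monomial, eval_monomial, eval_monomial, eval_monomial, hD,
      leibniz_pow hD]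
    ring

/-- A derivation kills the leading coefficient `1`. -/
theorem degree_mapCoeffs_lt {p : A[X]} (hp : p.Monic) :
    (mapCoeffs D p).degree < p.natDegree := by
  nontriviality A
  rw [degree_lt_iff_coeff_zero]
  intro k hk
  rw [coeff_mapCoeffs]
  rcases hk.eq_or_lt with rfl | hk
  · rw [hp.coeff_natDegree, leibniz_one hD]
  · rw [coeff_eq_zero_of_natDegree_lt hk, map_zero]

end MapCoeffs

/-! ### Lagrange coordinates and the identities satisfied by `w = u f_x + v f_y` -/

section Interpolation

variable {K : Type*} [Field K] (s : Finset K)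

/-- The monic polynomial with simple roots at the elements of `s`. -/
def rootPoly : K[X] := Lagrange.nodal s id

variable {s}

theorem eval_rootPoly {a : K} (ha : a ∈ s) : (rootPoly s).eval a = 0 :=
  Lagrange.eval_nodal_at_node (v := (id : K → K)) ha

theorem rootPoly_monic : (rootPoly s).Monic := Lagrange.nodal_monic

theorem natDegree_rootPoly : (rootPoly s).natDegree = s.card := Lagrange.natDegree_nodal

theorem degree_derivative_rootPoly_lt :
    (derivative (rootPoly s)).degree < s.card := by
  have := degree_derivative_lt (rootPoly_monic (s := s)).ne_zero
  rwa [degree_eq_natDegree rootPoly_monic.ne_zero, natDegree_rootPoly] at this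

theorem leibniz_div {D : K →+ K} (hD : ∀ a b, D (a * b) = a * D b + b * D a) {a b : K} (hb : b ≠ 0) : D (a / b) = (D a - a / b * D b) / b := by
  have h := hD (a / b) b
  rw [div_mul_cancel₀ _ hb] at h
  rw [eq_div_iff hb, h]
  ring

/-- Differentiate `f(x, a(x)) = 0` by the chain rule. -/
theorem eval_mapCoeffs_rootPoly {D : K →+ K}
    (hD : ∀ a b, D (a * b) = a * D b + b * D a) {a : K} (ha : a ∈ s) :
    (mapCoeffs D (rootPoly s)).eval a = -((derivative (rootPoly s)).eval a * D a) := by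
  have h := leibniz_eval hD (rootPoly s) a
  rw [eval_rootPoly ha, map_zero] at h
  exact eq_neg_of_add_eq_zero_left h.symm

variable [DecidableEq K]

theorem eval_derivative_rootPoly {a : K} (ha : a ∈ s) :
    (derivative (rootPoly s)).eval a = ∏ b ∈ s.erase a, (a - b) := by
  have := Lagrange.eval_nodal_derivative_eval_node_eq (v := (id : K → K)) ha
  rw [Lagrange.eval_nodal] at this
  exact this

theorem eval_derivative_rootPoly_ne_zero {a : K} (ha : a ∈ s) :
    (derivative (rootPoly s)).eval a ≠ 0 := by
  rw [eval_derivative_rootPoly ha, Finset.prod_ne_zero_iff]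
  intro b hb
  exact sub_ne_zero.2 (Finset.ne_of_mem_erase hb).symm

/-- Lagrange's interpolation formula. -/
theorem eq_sum_lagrange {p : K[X]} (hp : p.degree < s.card) :
    p = ∑ b ∈ s, C (p.eval b / (derivative (rootPoly s)).eval b) * rootPoly (s.erase b) := by
  refine eq_of_degree_sub_lt_of_eval_finset_eq s ?_ ?_
  · refine lt_of_le_of_lt (degree_sub_le _ _) (max_lt hp ?_)
    rw [degree_lt_iff_coeff_zero]
    intro k hk
    rw [finsetSum_coeff]
    refine Finset.sum_eq_zero fun b hb => ?_
    rw [coeff_C_mul, coeff_eq_zero_of_natDegree_lt, mul_zero]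
    rw [natDegree_rootPoly]
    exact lt_of_lt_of_le (Finset.card_erase_lt_of_mem hb) hk
  · intro a ha
    rw [eval_finsetSum, Finset.sum_eq_single_of_mem a ha]
    · rw [eval_mul, eval_C, eval_derivative_rootPoly ha, rootPoly, Lagrange.eval_nodal]
      refine (div_mul_cancel₀ _ ?_).symm
      exact eval_derivative_rootPoly ha ▸ eval_derivative_rootPoly_ne_zero ha
    · intro b _ hba
      rw [eval_mul, eval_rootPoly (Finset.mem_erase.2 ⟨hba.symm, ha⟩), mul_zero]

theorem eval_derivative_rootPoly_eq {a b : K} (ha : a ∈ s) (hb : b ∈ s.erase a) :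
    (derivative (rootPoly s)).eval a = (a - b) * ∏ c ∈ (s.erase a).erase b, (a - c) := by
  rw [eval_derivative_rootPoly ha, Finset.mul_prod_erase _ (fun c => a - c) hb]

/-- The `y`-derivative at a node in terms of the coordinates in the Lagrange basis. -/
theorem eval_derivative_div_eq_sum {p : K[X]} (hp : p.degree < s.card) {a : K} (ha : a ∈ s) :
    (derivative p).eval a / (derivative (rootPoly s)).eval a =
      ∑ b ∈ s.erase a, (p.eval a / (derivative (rootPoly s)).eval a +
        p.eval b / (derivative (rootPoly s)).eval b) / (a - b) := by
  have h0 := eval_derivative_rootPoly_ne_zero ha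
  have hsub : ∀ b ∈ s.erase a, a - b ≠ 0 := fun b hb =>
    sub_ne_zero.2 (Finset.ne_of_mem_erase hb).symm
  -- Both derivatives are products of differences, and they differ by the single factor `a - b`.
  have key : ∀ b ∈ s.erase a, (derivative (rootPoly (s.erase b))).eval a /
      (derivative (rootPoly s)).eval a = 1 / (a - b) := by
    intro b hb
    have hab : a ∈ s.erase b :=
      Finset.mem_erase.2 ⟨(Finset.ne_of_mem_erase hb).symm, ha⟩
    rw [eval_derivative_rootPoly hab, div_eq_div_iff h0 (hsub b hb),
      eval_derivative_rootPoly_eq ha hb, Finset.erase_right_comm]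
    ring
  have key' : (derivative (rootPoly (s.erase a))).eval a / (derivative (rootPoly s)).eval a =
      ∑ b ∈ s.erase a, 1 / (a - b) := by
    rw [rootPoly, Lagrange.derivative_nodal, eval_finsetSum, Finset.sum_div]
    refine Finset.sum_congr rfl fun b hb => ?_
    rw [div_eq_div_iff h0 (hsub b hb), Lagrange.eval_nodal, eval_derivative_rootPoly_eq ha hb]
    simp only [id]
    ring
  conv_lhs => rw [eq_sum_lagrange hp]
  simp only [derivative_sum, eval_finsetSum, derivative_C_mul, eval_mul, eval_C, Finset.sum_div,
    mul_div_assoc]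
  rw [← Finset.add_sum_erase s _ ha, key', Finset.mul_sum, ← Finset.sum_add_distrib]
  refine Finset.sum_congr rfl fun b hb => ?_
  rw [key b hb]
  ring

theorem eval_derivative_derivative_rootPoly_div {a : K} (ha : a ∈ s) :
    (derivative (derivative (rootPoly s))).eval a / (derivative (rootPoly s)).eval a =
      ∑ b ∈ s.erase a, 2 / (a - b) := by
  rw [eval_derivative_div_eq_sum degree_derivative_rootPoly_lt ha]
  refine Finset.sum_congr rfl fun b hb => ?_
  rw [div_self (eval_derivative_rootPoly_ne_zero ha),
    div_self (eval_derivative_rootPoly_ne_zero (Finset.mem_of_mem_erase hb)), one_add_one_eq_two]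

/-- The basis polynomials are monic of degree `n - 1`, so the sum of the coordinates is the
coefficient of `y^(n-1)`. -/
theorem sum_eval_div_eq_zero {p : K[X]} (hp : p.degree < (s.card - 1 : ℕ)) :
    ∑ a ∈ s, p.eval a / (derivative (rootPoly s)).eval a = 0 := by
  have h := Lagrange.coeff_eq_sum (s := s) (v := (id : K → K)) (Set.injOn_id _)
    (hp.trans_le (by exact_mod_cast Nat.sub_le _ _))
  rw [coeff_eq_zero_of_degree_lt hp] at h
  rw [h]
  exact Finset.sum_congr rfl fun a ha => by rw [eval_derivative_rootPoly ha]; rfl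

/-- Divided by `f_y(a)`, both sides are the residue of `w / f^2` at `y = a`: the right one by Taylor
expansion, the left one in coordinates. -/
theorem residue_eq {w : K[X]} (hw : w.degree < s.card) {a : K} (ha : a ∈ s) :
    (∑ b ∈ s.erase a, (w.eval b / (derivative (rootPoly s)).eval b -
      w.eval a / (derivative (rootPoly s)).eval a) / (a - b)) =
    (derivative w).eval a / (derivative (rootPoly s)).eval a -
      w.eval a / (derivative (rootPoly s)).eval a *
        ((derivative (derivative (rootPoly s))).eval a / (derivative (rootPoly s)).eval a) := by
  rw [eval_derivative_div_eq_sum hw ha, eval_derivative_derivative_rootPoly_div ha,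
    Finset.mul_sum, ← Finset.sum_sub_distrib]
  refine Finset.sum_congr rfl fun b hb => ?_
  ring

variable {D : K →+ K} (hD : ∀ a b, D (a * b) = a * D b + b * D a)
include hD

/-- The coordinates of the divergence `u_x + v_y` of a representation `w = u f_x + v f_y`. -/
theorem divergence_div_eq {u v w : K[X]} (hw : w.degree < s.card)
    (h : w = u * mapCoeffs D (rootPoly s) + v * derivative (rootPoly s)) {a : K} (ha : a ∈ s) :
    (mapCoeffs D u + derivative v).eval a / (derivative (rootPoly s)).eval a =
      D (u.eval a / (derivative (rootPoly s)).eval a) +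
      (∑ b ∈ s.erase a, (w.eval b / (derivative (rootPoly s)).eval b -
        w.eval a / (derivative (rootPoly s)).eval a) / (a - b)) /
        (derivative (rootPoly s)).eval a := by
  have h0 := eval_derivative_rootPoly_ne_zero ha
  -- This is the residue at `y = a` of `w / f^2 = (u_x + v_y) / f - ∂_x (u / f) - ∂_y (v / f)`,
  -- checked by the quotient and chain rules.
  rw [residue_eq hw ha, leibniz_div hD h0, leibniz_eval hD u, leibniz_eval hD (derivative _)]
  have h1 : w.eval a = _ := congrArg (eval a) h
  have h2 : (derivative w).eval a = _ := congrArg (fun p => (derivative p).eval a) h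
  simp only [derivative_add, derivative_mul, eval_add, eval_mul, derivative_mapCoeffs,
    eval_mapCoeffs_rootPoly hD ha] at h1 h2
  rw [h1, h2, eval_add]
  field_simp
  ring

/-- The Laplacian-type equations satisfied by the coordinates of `u` in `w = u f_x + v f_y`. -/
theorem laplacian_eq {u v w : K[X]} (hw : w.degree < s.card) (hu : u.degree < s.card)
    (hv : v.degree < s.card)
    (h : w = u * mapCoeffs D (rootPoly s) + v * derivative (rootPoly s)) {a : K} (ha : a ∈ s) :
    ∑ b ∈ s.erase a, (D (a - b) / (a - b)) * (u.eval a / (derivative (rootPoly s)).eval a -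
      u.eval b / (derivative (rootPoly s)).eval b) =
    ∑ b ∈ s.erase a, ((w.eval b / (derivative (rootPoly s)).eval b -
        w.eval a / (derivative (rootPoly s)).eval a) / (derivative (rootPoly s)).eval a -
      (w.eval a / (derivative (rootPoly s)).eval a / (derivative (rootPoly s)).eval a +
        w.eval b / (derivative (rootPoly s)).eval b / (derivative (rootPoly s)).eval b)) /
        (a - b) := by
  have h0 := eval_derivative_rootPoly_ne_zero ha
  -- In coordinates, `W_b / N_b = V_b - U_b D b`; this is what eliminates `v`.
  have hw' : ∀ b ∈ s, w.eval b / (derivative (rootPoly s)).eval b /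
      (derivative (rootPoly s)).eval b = v.eval b / (derivative (rootPoly s)).eval b -
        u.eval b / (derivative (rootPoly s)).eval b * D b := by
    intro b hb
    have h1 : w.eval b = _ := congrArg (eval b) h
    have h0 := eval_derivative_rootPoly_ne_zero hb
    rw [h1]
    simp only [eval_add, eval_mul, eval_mapCoeffs_rootPoly hD hb]
    field_simp
    ring
  have h2 : (derivative w).eval a = _ := congrArg (fun p => (derivative p).eval a) h
  simp only [derivative_add, derivative_mul, eval_add, eval_mul,
    eval_mapCoeffs_rootPoly hD ha] at h2
  have hfx := degree_mapCoeffs_lt hD (rootPoly_monic (s := s))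
  rw [natDegree_rootPoly] at hfx
  have e1 := eval_derivative_div_eq_sum hu ha
  have e2 := eval_derivative_div_eq_sum hv ha
  have e3 := eval_derivative_div_eq_sum hfx ha
  have e4 := eval_derivative_derivative_rootPoly_div ha
  have e5 := residue_eq hw ha
  set N := (derivative (rootPoly s)).eval a with hN
  have e6 : (derivative w).eval a / N / N = -(D a) * ((derivative u).eval a / N) +
      u.eval a / N * ((derivative (mapCoeffs D (rootPoly s))).eval a / N) +
      (derivative v).eval a / N +
      v.eval a / N * ((derivative (derivative (rootPoly s))).eval a / N) := by
    rw [h2]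
    field_simp
    ring
  -- With `e6`, two expressions of the residue of `w / f^2`. Once every `y`-derivative is expanded
  -- by `e1`–`e4`, the desired identity holds term by term in `b`.
  have e7 : (∑ b ∈ s.erase a, (w.eval b / (derivative (rootPoly s)).eval b -
      w.eval a / N) / (a - b)) / N = (derivative w).eval a / N / N -
      w.eval a / N / N * ((derivative (derivative (rootPoly s))).eval a / N) := by
    rw [e5]; ring
  rw [e6, hw' a ha, ← hN, e1, e2, e3, e4, Finset.sum_div] at e7
  simp only [Finset.mul_sum, ← Finset.sum_add_distrib, ← Finset.sum_sub_distrib] at e7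
  simp only [sub_div _ _ (_ - _)]
  rw [Finset.sum_sub_distrib]
  simp only [div_right_comm _ N (_ - _)]
  rw [e7, ← Finset.sum_sub_distrib]
  refine Finset.sum_congr rfl fun b hb => ?_
  have hb' := Finset.mem_of_mem_erase hb
  rw [hw' b hb', eval_mapCoeffs_rootPoly hD ha, eval_mapCoeffs_rootPoly hD hb', map_sub, hw' a ha]
  have h0' := eval_derivative_rootPoly_ne_zero hb'
  have hs : a - b ≠ 0 := sub_ne_zero.2 (Finset.ne_of_mem_erase hb).symm
  rw [← hN]
  field_simp
  ring

end Interpolation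

/-! ### Orders of Hahn series and the Laplacian estimate -/

section Order

variable {a b : HahnSeries ℚ ℂ} {r t : ℚ}

theorem le_orderTop_mul (ha : (r : WithTop ℚ) ≤ a.orderTop) (hb : (t : WithTop ℚ) ≤ b.orderTop) :
    ((r + t : ℚ) : WithTop ℚ) ≤ (a * b).orderTop := by
  rw [HahnSeries.orderTop_mul, WithTop.coe_add]
  exact add_le_add ha hb

theorem le_orderTop_add (ha : (r : WithTop ℚ) ≤ a.orderTop) (hb : (r : WithTop ℚ) ≤ b.orderTop) :
    (r : WithTop ℚ) ≤ (a + b).orderTop :=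
  (le_min ha hb).trans HahnSeries.min_orderTop_le_orderTop_add

theorem le_orderTop_sub (ha : (r : WithTop ℚ) ≤ a.orderTop) (hb : (r : WithTop ℚ) ≤ b.orderTop) :
    (r : WithTop ℚ) ≤ (a - b).orderTop :=
  (le_min ha hb).trans HahnSeries.min_orderTop_le_orderTop_sub

theorem le_orderTop_sum {ι : Type*} {s : Finset ι} {g : ι → HahnSeries ℚ ℂ}
    (h : ∀ i ∈ s, (r : WithTop ℚ) ≤ (g i).orderTop) :
    (r : WithTop ℚ) ≤ (∑ i ∈ s, g i).orderTop :=
  AddValuation.map_le_sum (HahnSeries.addVal ℚ ℂ) h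

theorem ne_zero_of_orderTop_eq (hb : b.orderTop = t) : b ≠ 0 := by
  rintro rfl
  simp at hb

theorem exists_orderTop_eq (hb : b ≠ 0) : ∃ t : ℚ, b.orderTop = t :=
  (WithTop.ne_top_iff_exists.1 (HahnSeries.orderTop_ne_top.2 hb)).imp fun _ h => h.symm

theorem orderTop_div_add (hb : b ≠ 0) : (a / b).orderTop + b.orderTop = a.orderTop := by
  rw [← HahnSeries.orderTop_mul, div_mul_cancel₀ _ hb]

theorem le_orderTop_div (ha : (r : WithTop ℚ) ≤ a.orderTop) (hb : b.orderTop = t) :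
    ((r - t : ℚ) : WithTop ℚ) ≤ (a / b).orderTop := by
  have h := orderTop_div_add (a := a) (ne_zero_of_orderTop_eq hb)
  rw [← h, hb] at ha
  refine (WithTop.add_le_add_iff_right (WithTop.coe_ne_top (a := t))).1 ?_
  rwa [← WithTop.coe_add, sub_add_cancel]

theorem le_orderTop_of_le (h : r ≤ t) (ha : (t : WithTop ℚ) ≤ a.orderTop) :
    (r : WithTop ℚ) ≤ a.orderTop :=
  (WithTop.coe_le_coe.2 h).trans ha

/-- If `b` has order `m` and `u` has order at least `μ`, then the coefficient of `(x b' / b) u` at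
`μ` is `m` times that of `u`. -/
theorem coeff_logDeriv_mul {b u : HahnSeries ℚ ℂ} {m μ : ℚ} (hb : b.orderTop = m)
    (hu : (μ : WithTop ℚ) ≤ u.orderTop) :
    (eulerHom b / b * u).coeff μ = (m : ℂ) * u.coeff μ := by
  have hb0 := ne_zero_of_orderTop_eq hb
  -- The error term `x b' / b - m`, of positive order.
  set e := (eulerHom b - HahnSeries.C (m : ℂ) * b) / b with he
  have hepos : (0 : WithTop ℚ) < e.orderTop := by
    have h := orderTop_div_add (a := eulerHom b - HahnSeries.C (m : ℂ) * b) hb0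
    have h1 := lt_orderTop_eulerHom_sub hb
    rw [← h, hb, ← he] at h1
    by_contra hle
    have h2 : e.orderTop + (m : WithTop ℚ) ≤ 0 + m := by gcongr; exact not_lt.1 hle
    rw [zero_add] at h2
    exact absurd h1 (not_lt.2 h2)
  have hdecomp : eulerHom b / b * u = HahnSeries.C (m : ℂ) * u + e * u := by
    rw [he]
    field_simp
    ring
  have hlt : (μ : WithTop ℚ) < (e * u).orderTop := by
    rw [HahnSeries.orderTop_mul]
    by_cases hu0 : u = 0
    · simp [hu0]
    · obtain ⟨t, ht⟩ := exists_orderTop_eq hu0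
      rw [ht] at hu ⊢
      refine hu.trans_lt ?_
      by_contra hle
      have := (WithTop.add_le_add_iff_right (WithTop.coe_ne_top (a := t))).1
        ((not_lt.1 hle).trans_eq (zero_add _).symm)
      exact absurd hepos (not_lt.2 this)
  rw [hdecomp, HahnSeries.coeff_add, HahnSeries.coeff_eq_zero_of_lt_orderTop hlt, add_zero,
    HahnSeries.C_mul_eq_smul, HahnSeries.coeff_smul, smul_eq_mul]

end Order

/-- Maximum principle: harmonic functions on a complete weighted graph are constant. -/
theorem eq_of_weighted_laplacian_eq_zero {ι : Type*} [DecidableEq ι] {s : Finset ι}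
    {W : ι → ι → ℝ} (hW : ∀ a ∈ s, ∀ b ∈ s, a ≠ b → 0 < W a b) {c : ι → ℝ}
    (hc : ∀ a ∈ s, ∑ b ∈ s.erase a, W a b * (c a - c b) = 0) :
    ∀ a ∈ s, ∀ b ∈ s, c a = c b := by
  intro a ha b hb
  obtain ⟨m, hm, hmax⟩ := s.exists_max_image c ⟨a, ha⟩
  have h : ∀ e ∈ s, c e = c m := by
    intro e he
    by_cases hem : e = m
    · rw [hem]
    -- At a maximum every term of the Laplacian is nonnegative, so each vanishes.
    have h0 := (Finset.sum_eq_zero_iff_of_nonneg fun e he =>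
      mul_nonneg (hW m hm e (Finset.mem_of_mem_erase he) (Finset.ne_of_mem_erase he).symm).le
        (sub_nonneg.2 (hmax e (Finset.mem_of_mem_erase he)))).1 (hc m hm) e
          (Finset.mem_erase.2 ⟨hem, he⟩)
    rcases mul_eq_zero.1 h0 with h | h
    · exact absurd h (hW m hm e he (Ne.symm hem)).ne'
    · linarith
  rw [h a ha, h b hb]

open scoped Classical in
/-- A Laplacian estimate: solutions of sum zero of the system with weights `x (a - b)' / (a - b)`
have at least the order of the right-hand side. -/
theorem le_orderTop_of_laplacian {s : Finset (HahnSeries ℚ ℂ)}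
    (hs : ∀ a ∈ s, ∀ b ∈ s, a ≠ b → 0 < (a - b).orderTop)
    {u : HahnSeries ℚ ℂ → HahnSeries ℚ ℂ} (hsum : ∑ a ∈ s, u a = 0) {ρ : ℚ}
    (hL : ∀ a ∈ s, (ρ : WithTop ℚ) ≤
      (∑ b ∈ s.erase a, eulerHom (a - b) / (a - b) * (u a - u b)).orderTop) :
    ∀ a ∈ s, (ρ : WithTop ℚ) ≤ (u a).orderTop := by
  by_contra! hcon
  obtain ⟨a₁, ha₁, hlt₁⟩ := hcon
  obtain ⟨a₀, ha₀, hmin⟩ := s.exists_min_image (fun a => (u a).orderTop) ⟨a₁, ha₁⟩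
  have hlt := (hmin a₁ ha₁).trans_lt hlt₁
  obtain ⟨μ, hμ⟩ := WithTop.ne_top_iff_exists.1 hlt.ne_top
  rw [← hμ] at hlt
  have hle : ∀ a ∈ s, (μ : WithTop ℚ) ≤ (u a).orderTop := fun a ha => hμ ▸ hmin a ha
  -- For distinct series the default value of `untopD` is never taken.
  have hm : ∀ a b : HahnSeries ℚ ℂ, a ≠ b → (((a - b).orderTop.untopD 0 : ℚ) : WithTop ℚ) = (a - b).orderTop := by
    intro a b hab
    obtain ⟨t, ht⟩ := exists_orderTop_eq (sub_ne_zero.2 hab)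
    rw [ht]; rfl
  -- Coefficient of the system at the minimal order `μ < ρ`: the right-hand side does not
  -- contribute, and each weight acts through its leading coefficient.
  have hc : ∀ a ∈ s, ∑ b ∈ s.erase a,
      (((a - b).orderTop.untopD 0 : ℚ) : ℂ) * ((u a).coeff μ - (u b).coeff μ) = 0 := by
    intro a ha
    have h := HahnSeries.coeff_eq_zero_of_lt_orderTop (hlt.trans_le (hL a ha))
    rw [HahnSeries.coeff_sum] at h
    rw [← h]
    refine Finset.sum_congr rfl fun b hb => ?_
    rw [coeff_logDeriv_mul (hm a b (Finset.ne_of_mem_erase hb).symm).symm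
      (le_orderTop_sub (hle a ha) (hle b (Finset.mem_of_mem_erase hb))), HahnSeries.coeff_sub]
  have hW : ∀ a ∈ s, ∀ b ∈ s, a ≠ b → (0 : ℝ) < (((a - b).orderTop.untopD 0 : ℚ) : ℝ) := by
    intro a ha b hb hab
    have h := hs a ha b hb hab
    rw [← hm a b hab] at h
    exact_mod_cast h
  -- The weights are real, so real and imaginary parts are separately harmonic.
  have hre := eq_of_weighted_laplacian_eq_zero hW (c := fun a => ((u a).coeff μ).re)
    fun a ha => by
      have := congrArg Complex.re (hc a ha)
      simpa [Complex.re_sum, Complex.mul_re] using this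
  have him := eq_of_weighted_laplacian_eq_zero hW (c := fun a => ((u a).coeff μ).im)
    fun a ha => by
      have := congrArg Complex.im (hc a ha)
      simpa [Complex.im_sum, Complex.mul_im] using this
  have hconst : ∀ a ∈ s, (u a).coeff μ = (u a₀).coeff μ := fun a ha =>
    Complex.ext (hre a ha a₀ ha₀) (him a ha a₀ ha₀)
  have h0 : (∑ a ∈ s, u a).coeff μ = 0 := by rw [hsum]; rfl
  rw [HahnSeries.coeff_sum, Finset.sum_congr rfl hconst, Finset.sum_const, nsmul_eq_mul,
    mul_eq_zero, Nat.cast_eq_zero, Finset.card_eq_zero] at h0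
  rcases h0 with h0 | h0
  · simp [h0] at ha₀
  · exact HahnSeries.coeff_orderTop_ne hμ.symm h0

/-! ### Lower bounds for the coordinates of `u`, `v` and the divergence -/

/-- The coordinate `p(x, a) / f'_y(x, a)` of `p` in the Lagrange basis attached to the root `a`
of the polynomial `f` whose roots are the elements of `s`. -/
def coord (s : Finset (HahnSeries ℚ ℂ)) (p : (HahnSeries ℚ ℂ)[X]) (a : HahnSeries ℚ ℂ) :
    HahnSeries ℚ ℂ :=
  p.eval a / (derivative (rootPoly s)).eval a

section Bounds

variable {s : Finset (HahnSeries ℚ ℂ)} {ϖ r : ℚ}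
  (hϖ : ∀ a ∈ s, ∀ b ∈ s, a ≠ b → ∃ m t : ℚ,
    ((derivative (rootPoly s)).eval a).orderTop = m ∧ (a - b).orderTop = t ∧ m + t ≤ ϖ)
include hϖ

open scoped Classical in
-- Each term has order at least `r - m_{a,b} - m_a`, and `ϖ` bounds `m_a + m_{a,b}`.
theorem le_orderTop_residue {w : (HahnSeries ℚ ℂ)[X]}
    (hr : ∀ a ∈ s, (r : WithTop ℚ) ≤ (coord s w a).orderTop) {a : HahnSeries ℚ ℂ} (ha : a ∈ s) :
    ((r - ϖ : ℚ) : WithTop ℚ) ≤ ((∑ b ∈ s.erase a, (coord s w b - coord s w a) / (a - b)) /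
      (derivative (rootPoly s)).eval a).orderTop := by
  rw [Finset.sum_div]
  refine le_orderTop_sum fun b hb => ?_
  obtain ⟨m, t, hm, ht, hmt⟩ := hϖ a ha b (Finset.mem_of_mem_erase hb)
    (Finset.ne_of_mem_erase hb).symm
  exact le_orderTop_of_le (by linarith) (le_orderTop_div (le_orderTop_div
    (le_orderTop_sub (hr b (Finset.mem_of_mem_erase hb)) (hr a ha)) ht) hm)

/-- The divergence `u_x + v_y` of a representation `w = u f_x + v f_y`. -/
theorem le_orderTop_divergence {u v w : (HahnSeries ℚ ℂ)[X]} (hw : w.degree < s.card)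
    (h : w = u * mapCoeffs hahnD (rootPoly s) + v * derivative (rootPoly s))
    (hr : ∀ a ∈ s, (r : WithTop ℚ) ≤ (coord s w a).orderTop)
    (hu : ∀ a ∈ s, ((r - ϖ + 1 : ℚ) : WithTop ℚ) ≤ (coord s u a).orderTop) :
    ∀ a ∈ s, ((r - ϖ : ℚ) : WithTop ℚ) ≤
      (coord s (mapCoeffs hahnD u + derivative v) a).orderTop := by
  classical
  intro a ha
  rw [coord, divergence_div_eq hahnD_mul hw h ha]
  refine le_orderTop_add ?_ (le_orderTop_residue hϖ hr ha)
  have h1 := le_orderTop_hahnD (hu a ha)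
  rw [add_sub_cancel_right] at h1
  exact h1

/-- The Laplacian estimate applied to `laplacian_eq`. Multiplying by `x` turns `d/dx` into the Euler
operator and gains the `1` in `ϖ - 1`. -/
theorem le_orderTop_coord_left {u v w : (HahnSeries ℚ ℂ)[X]} (hw : w.degree < s.card)
    (hu : u.degree < (s.card - 1 : ℕ)) (hv : v.degree < (s.card - 1 : ℕ))
    (hs : ∀ a ∈ s, 0 < a.orderTop)
    (h : w = u * mapCoeffs hahnD (rootPoly s) + v * derivative (rootPoly s))
    (hr : ∀ a ∈ s, (r : WithTop ℚ) ≤ (coord s w a).orderTop) :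
    ∀ a ∈ s, ((r - (ϖ - 1) : ℚ) : WithTop ℚ) ≤ (coord s u a).orderTop := by
  classical
  have hcard : ((s.card - 1 : ℕ) : WithBot ℕ) ≤ s.card := by exact_mod_cast Nat.sub_le _ _
  refine le_orderTop_of_laplacian (u := coord s u) (fun a ha b hb hab => ?_) (sum_eval_div_eq_zero hu)
    fun a ha => ?_
  · exact (lt_min (hs a ha) (hs b hb)).trans_le HahnSeries.min_orderTop_le_orderTop_sub
  · have hx : ∀ b, eulerHom (a - b) / (a - b) * (coord s u a - coord s u b) =
        HahnSeries.single (1 : ℚ) (1 : ℂ) *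
          (hahnD (a - b) / (a - b) * (coord s u a - coord s u b)) := by
      intro b
      rw [← single_mul_hahnD]
      ring
    have h1 := laplacian_eq hahnD_mul hw (hu.trans_le hcard) (hv.trans_le hcard) h ha
    simp only [hx]
    rw [← Finset.mul_sum]
    have h2 : ((r - (ϖ - 1) : ℚ) : WithTop ℚ) = ((1 + (r - ϖ) : ℚ) : WithTop ℚ) := by
      congr 1; ring
    rw [h2]
    refine le_orderTop_mul HahnSeries.orderTop_single_le ?_
    refine le_of_le_of_eq ?_ (congrArg HahnSeries.orderTop h1.symm)
    refine le_orderTop_sum fun b hb => ?_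
    have hb' := Finset.mem_of_mem_erase hb
    have hab := (Finset.ne_of_mem_erase hb).symm
    obtain ⟨m, t, hm, ht, hmt⟩ := hϖ a ha b hb' hab
    obtain ⟨m', t', hm', ht', hmt'⟩ := hϖ b hb' a ha hab.symm
    have htt : t' = t := by
      rw [← HahnSeries.orderTop_neg, neg_sub, ht] at ht'
      exact_mod_cast ht'.symm
    subst htt
    -- The numerator has order at least `r - ϖ + t'`, as `m` and `m'` are both at most `ϖ - t'`; the
    -- term divided by `f_y(b)` is why the pair `(b, a)` is needed too.
    refine le_orderTop_of_le (t := (r - ϖ + t') - t') (by linarith) (le_orderTop_div ?_ ht)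
    refine le_orderTop_sub ?_ (le_orderTop_add ?_ ?_)
    · exact le_orderTop_of_le (by linarith)
        (le_orderTop_div (le_orderTop_sub (hr b hb') (hr a ha)) hm)
    · exact le_orderTop_of_le (by linarith) (le_orderTop_div (hr a ha) hm)
    · exact le_orderTop_of_le (by linarith) (le_orderTop_div (hr b hb') hm')

theorem le_orderTop_coord_right {u v w : (HahnSeries ℚ ℂ)[X]} {δ : ℚ}
    (hcard : 1 < s.card) (hδ : ∀ a ∈ s, (δ : WithTop ℚ) ≤ a.orderTop)
    (h : w = u * mapCoeffs hahnD (rootPoly s) + v * derivative (rootPoly s))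
    (hr : ∀ a ∈ s, (r : WithTop ℚ) ≤ (coord s w a).orderTop)
    (hu : ∀ a ∈ s, ((r - (ϖ - 1) : ℚ) : WithTop ℚ) ≤ (coord s u a).orderTop) :
    ∀ a ∈ s, ((r - (ϖ - δ) : ℚ) : WithTop ℚ) ≤ (coord s v a).orderTop := by
  classical
  intro a ha
  -- A second root gives `m_a ≤ ϖ - m_{a,b} ≤ ϖ - δ`.
  obtain ⟨b, hb, hba⟩ := Finset.exists_mem_ne hcard a
  obtain ⟨m, t, hm, ht, hmt⟩ := hϖ a ha b hb hba.symm
  have hδt : δ ≤ t := WithTop.coe_le_coe.1 (ht ▸ le_orderTop_sub (hδ a ha) (hδ b hb))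
  have h0 := eval_derivative_rootPoly_ne_zero ha
  have hv : coord s v a = coord s w a / (derivative (rootPoly s)).eval a +
      coord s u a * hahnD a := by
    have h1 : w.eval a = _ := congrArg (eval a) h
    simp only [eval_add, eval_mul, eval_mapCoeffs_rootPoly hahnD_mul ha] at h1
    unfold coord
    rw [h1]
    field_simp
    ring
  rw [hv]
  refine le_orderTop_add ?_ ?_
  · exact le_orderTop_of_le (by linarith) (le_orderTop_div (hr a ha) hm)
  · exact le_orderTop_of_le (by linarith)
      (le_orderTop_mul (hu a ha) (le_orderTop_hahnD (hδ a ha)))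

end Bounds

/-! ### The Newton–Puiseux theorem -/

/-- Hensel's lemma in the form of a proper factorization: a polynomial over a complete local ring whose
reduction is divisible by `y` and has a nonzero coefficient below the degree of the polynomial has a proper monic factor. -/
theorem exists_monic_dvd_of_complete {A : Type*} [CommRing A] [IsLocalRing A]
    [IsAdicComplete (IsLocalRing.maximalIdeal A) A] {Q : A[X]}
    (h0 : Q.coeff 0 ∈ IsLocalRing.maximalIdeal A)
    (hk : ∃ k < Q.natDegree, Q.coeff k ∉ IsLocalRing.maximalIdeal A) :
    ∃ G : A[X], G.Monic ∧ G ∣ Q ∧ 0 < G.natDegree ∧ G.natDegree < Q.natDegree := by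
  obtain ⟨k, hkn, hk⟩ := hk
  have hcoeff : ∀ i, PowerSeries.coeff i ((Q : PowerSeries A).map (IsLocalRing.residue A)) =
      IsLocalRing.residue A (Q.coeff i) := fun i => by
    rw [PowerSeries.coeff_map, Polynomial.coeff_coe]
  have hk' : PowerSeries.coeff k ((Q : PowerSeries A).map (IsLocalRing.residue A)) ≠ 0 := by
    rw [hcoeff, Ne, IsLocalRing.residue_eq_zero_iff]
    exact hk
  have hne : (Q : PowerSeries A).map (IsLocalRing.residue A) ≠ 0 := fun h => hk' (by simp [h])
  obtain ⟨G, h, H⟩ := (Q : PowerSeries A).exists_isWeierstrassFactorization hne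
  have hG := H.isDistinguishedAt
  have hdeg : (G.natDegree : ℕ∞) =
      ((Q : PowerSeries A).map (IsLocalRing.residue A)).order := by
    refine hG.coe_natDegree_eq_order_map _ h ?_ H.eq_mul
    rw [IsLocalRing.mem_maximalIdeal, mem_nonunits_iff, not_not]
    exact PowerSeries.isUnit_iff_constantCoeff.1 H.isUnit
  refine ⟨G, hG.monic, ?_, ?_, ?_⟩
  · have hW := hG.isWeierstrassDivisorAt'
    have hG' : G.degree = (((G : PowerSeries A).map (Ideal.Quotient.mk
        (IsLocalRing.maximalIdeal A))).order.toNat : WithBot ℕ) := by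
      have := hG.coe_natDegree_eq_order_map (G : PowerSeries A) 1
        (by simp) (by simp)
      rw [← this, degree_eq_natDegree hG.monic.ne_zero]
      simp
    -- Weierstrass division by `G` is unique, so the polynomial remainder agrees with the remainder
    -- `0` of `Q = G * h`.
    have := hW.eq_of_mul_add_eq_mul_add (q := h) (q' := ((Q /ₘ G : A[X]) : PowerSeries A))
      (r := 0) (r' := Q %ₘ G) (by rw [← hG']; simp [bot_lt_iff_ne_bot, hG.monic.ne_zero])
      (by rw [← hG']; exact degree_modByMonic_lt _ hG.monic) (by
        rw [Polynomial.coe_zero, add_zero, ← H.eq_mul, ← Polynomial.coe_mul, ← Polynomial.coe_add,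
          add_comm, modByMonic_add_div])
    exact (modByMonic_eq_zero_iff_dvd hG.monic).1 this.2.symm
  · refine Nat.pos_of_ne_zero fun h0' => ?_
    rw [h0', eq_comm, PowerSeries.order_eq_nat, hcoeff] at hdeg
    exact hdeg.1 ((IsLocalRing.residue_eq_zero_iff _).2 h0)
  · rw [← ENat.natCast_lt_natCast, hdeg]
    exact (PowerSeries.order_le k hk').trans_lt (by exact_mod_cast hkn)

theorem exists_proper_monic_dvd {Q : ℂ⟦X⟧[X]}
    (hc : (Q.map PowerSeries.constantCoeff).coeff 0 = 0)
    (hk : ∃ k < Q.natDegree, (Q.map PowerSeries.constantCoeff).coeff k ≠ 0) :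
    ∃ G : ℂ⟦X⟧[X], G.Monic ∧ G ∣ Q ∧ 0 < G.natDegree ∧ G.natDegree < Q.natDegree := by
  have hm : ∀ a : ℂ⟦X⟧, a ∈ IsLocalRing.maximalIdeal ℂ⟦X⟧ ↔ PowerSeries.constantCoeff a = 0 := by
    intro a
    rw [PowerSeries.maximalIdeal_eq_span_X, Ideal.mem_span_singleton, PowerSeries.X_dvd_iff]
  have : IsAdicComplete (IsLocalRing.maximalIdeal ℂ⟦X⟧) ℂ⟦X⟧ := by
    rw [PowerSeries.maximalIdeal_eq_span_X]
    infer_instance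
  refine exists_monic_dvd_of_complete ?_ ?_
  · rwa [hm, ← coeff_map]
  · simpa only [hm, ← coeff_map] using hk

/-- The Tschirnhaus transformation. -/
theorem coeff_taylor_tschirnhaus {K : Type*} [Field K] [CharZero K] {p : K[X]} (hp : p.Monic)
    (h0 : p.natDegree ≠ 0) :
    (taylor (-(p.coeff (p.natDegree - 1) / p.natDegree)) p).coeff (p.natDegree - 1) = 0 := by
  obtain ⟨n, hn⟩ := Nat.exists_eq_succ_of_ne_zero h0
  have hd : (hasseDeriv n p).natDegree < 2 := by
    have := natDegree_hasseDeriv_le p n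
    omega
  have h1 : p.coeff (n + 1) = 1 := by rw [← Nat.succ_eq_add_one, ← hn]; exact hp
  rw [taylor_coeff, hn, Nat.succ_eq_add_one, Nat.add_sub_cancel, eval_eq_sum_range' hd]
  simp only [Finset.sum_range_succ, Finset.sum_range_zero, hasseDeriv_coeff, zero_add,
    Nat.choose_self, add_comm 1 n, h1]
  have : ((n : K) + 1) ≠ 0 := by exact_mod_cast n.succ_ne_zero
  simp
  field_simp
  ring

theorem exists_ramify_of_finset (t : Finset (HahnSeries ℚ ℂ)) (ht : ∀ a ∈ t, a ∈ Puiseux) :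
    ∃ d : ℕ+, ∀ a ∈ t, a ∈ (ramify d).fieldRange := by
  classical
  induction t using Finset.induction_on with
  | empty => exact ⟨1, by simp⟩
  | insert a t _ ih =>
    obtain ⟨d, hd⟩ := ih fun b hb => ht b (Finset.mem_insert_of_mem hb)
    obtain ⟨e, g, hg⟩ := mem_Puiseux.1 (ht a (Finset.mem_insert_self a t))
    refine ⟨d * e, fun b hb => ?_⟩
    rcases Finset.mem_insert.1 hb with rfl | hb
    · rw [mul_comm]
      exact ramify_fieldRange_le e d ⟨g, hg⟩
    · exact ramify_fieldRange_le d e (hd b hb)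

theorem exists_powerSeries_eq {d : ℕ+} {a : HahnSeries ℚ ℂ} (ha : a ∈ (ramify d).fieldRange)
    (h0 : 0 ≤ a.orderTop) : ∃ g : ℂ⟦X⟧, ramify d (HahnSeries.ofPowerSeries ℤ ℂ g) = a := by
  obtain ⟨g, rfl⟩ := ha
  refine ⟨PowerSeries.mk fun n => g.coeff n, congrArg _ ?_⟩
  ext k
  rw [PowerSeries.coeff_coe]
  split_ifs with hk
  · rw [← coeff_ramify_mul_inv d g k, HahnSeries.coeff_eq_zero_of_lt_orderTop]
    refine lt_of_lt_of_le ?_ h0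
    have hd : (0 : ℚ) < (d : ℚ)⁻¹ := inv_pos.mpr (by exact_mod_cast d.pos)
    exact_mod_cast mul_neg_of_neg_of_pos (by exact_mod_cast hk) hd
  · rw [PowerSeries.coeff_mk, Int.natAbs_of_nonneg (not_lt.1 hk)]

/-- The embedding `ℂ[[t]] → ⋃ ℂ((x^(1/d)))`, `t ↦ x^(1/d)`. -/
def ramifyP (d : ℕ+) : ℂ⟦X⟧ →+* Puiseux :=
  ((ramify d).comp (HahnSeries.ofPowerSeries ℤ ℂ)).codRestrict Puiseux
    fun _ => mem_Puiseux.2 ⟨d, _, rfl⟩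

/-- Reduction modulo `t` is thereby read off as the coefficient of `x^0`. -/
theorem constantCoeff_eq (d : ℕ+) (g : ℂ⟦X⟧) :
    PowerSeries.constantCoeff g = (ramifyP d g : HahnSeries ℚ ℂ).coeff 0 := by
  have := coeff_ramify_mul_inv d (HahnSeries.ofPowerSeries ℤ ℂ g) 0
  rw [Int.cast_zero, zero_mul, PowerSeries.coeff_coe] at this
  exact Eq.trans (by simp) this.symm

theorem single_mem_Puiseux (q : ℚ) (c : ℂ) : HahnSeries.single q c ∈ Puiseux := by
  refine mem_Puiseux.2 ⟨⟨q.den, q.den_pos⟩, HahnSeries.single q.num c, ?_⟩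
  refine (HahnSeries.embDomain_single).trans ?_
  exact congrArg (fun r => HahnSeries.single r c)
    ((div_eq_mul_inv _ _).symm.trans (Rat.num_div_den q))

/-- Descent to power series of a monic polynomial with integral Puiseux coefficients. -/
theorem exists_map_ramifyP_eq {p : Puiseux[X]} (hp : p.Monic)
    (h0 : ∀ k, 0 ≤ (p.coeff k : HahnSeries ℚ ℂ).orderTop) :
    ∃ (d : ℕ+) (Q : ℂ⟦X⟧[X]), Q.map (ramifyP d) = p ∧ Q.natDegree = p.natDegree ∧ Q.Monic := by
  classical
  obtain ⟨d, hd⟩ := exists_ramify_of_finset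
    ((Finset.range (p.natDegree + 1)).image fun k => (p.coeff k : HahnSeries ℚ ℂ))
    (by
      intro a ha
      obtain ⟨k, _, rfl⟩ := Finset.mem_image.1 ha
      exact (p.coeff k).2)
  refine ⟨d, lifts_and_natDegree_eq_and_monic ?_ hp⟩
  rw [lifts_iff_coeff_lifts]
  intro k
  by_cases hk : k ≤ p.natDegree
  · obtain ⟨g, hg⟩ := exists_powerSeries_eq
      (hd _ (Finset.mem_image_of_mem _ (Finset.mem_range_succ_iff.2 hk))) (h0 k)
    exact ⟨g, Subtype.ext hg⟩
  · exact ⟨0, by rw [map_zero, coeff_eq_zero_of_natDegree_lt (not_le.1 hk)]⟩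

/-- Rescaling of the variable by a power of `x` making the Newton polygon horizontal. -/
theorem exists_scaleRoots_integral {p : Puiseux[X]} (hp : p.Monic) (hX : p ≠ X ^ p.natDegree) :
    ∃ c : Puiseux, c ≠ 0 ∧ (∀ k, 0 ≤ ((p.scaleRoots c).coeff k : HahnSeries ℚ ℂ).orderTop) ∧
      ∃ k < p.natDegree, ((p.scaleRoots c).coeff k : HahnSeries ℚ ℂ).orderTop = 0 := by
  classical
  set n := p.natDegree with hn
  set o : ℕ → ℚ := fun k => νQ (p.coeff k) with ho
  have hoeq : ∀ k, p.coeff k ≠ 0 → (p.coeff k : HahnSeries ℚ ℂ).orderTop = o k := by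
    intro k hk
    obtain ⟨t, ht⟩ := exists_orderTop_eq (b := (p.coeff k : HahnSeries ℚ ℂ))
      (fun h => hk (Subtype.ext h))
    simp [ho, νQ, ν, ht]
  obtain ⟨k₀, hk₀, hmin⟩ := Finset.exists_min_image
    ((Finset.range n).filter fun k => p.coeff k ≠ 0) (fun k => o k / ((n : ℚ) - k)) (by
      by_contra hempty
      rw [Finset.not_nonempty_iff_eq_empty, Finset.filter_eq_empty_iff] at hempty
      refine hX (Polynomial.ext fun k => ?_)
      rw [coeff_X_pow]
      rcases lt_trichotomy k n with h | h | h
      · rw [if_neg h.ne]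
        exact not_not.1 (hempty (Finset.mem_range.2 h))
      · rw [if_pos h, h]; exact hp
      · rw [if_neg h.ne', coeff_eq_zero_of_natDegree_lt h])
  rw [Finset.mem_filter, Finset.mem_range] at hk₀
  -- The least slope `o k / (n - k)`. Scaling the roots by `x^(-σ)` changes the order of the `k`-th
  -- coefficient to `o k - (n - k) σ`, which is nonnegative and vanishes at `k₀`.
  set σ : ℚ := o k₀ / ((n : ℚ) - k₀) with hσ
  have hpow : ∀ j : ℕ, (((⟨_, single_mem_Puiseux (-σ) 1⟩ : Puiseux) ^ j : Puiseux) :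
      HahnSeries ℚ ℂ).orderTop = ((-(j * σ) : ℚ) : WithTop ℚ) := by
    intro j
    rw [SubmonoidClass.coe_pow, HahnSeries.single_pow, one_pow,
      HahnSeries.orderTop_single one_ne_zero]
    simp
  have hord : ∀ k < n, p.coeff k ≠ 0 →
      ((p.scaleRoots ⟨_, single_mem_Puiseux (-σ) 1⟩).coeff k : HahnSeries ℚ ℂ).orderTop =
        ((o k - ((n : ℚ) - k) * σ : ℚ) : WithTop ℚ) := by
    intro k hk hk0
    rw [coeff_scaleRoots, MulMemClass.coe_mul, HahnSeries.orderTop_mul, hpow, hoeq k hk0,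
      ← WithTop.coe_add, ← hn, Nat.cast_sub hk.le, ← sub_eq_add_neg]
  refine ⟨⟨_, single_mem_Puiseux (-σ) 1⟩, fun h => ?_, fun k => ?_, k₀, hk₀.1, ?_⟩
  · exact HahnSeries.single_ne_zero one_ne_zero (congrArg Subtype.val h)
  · by_cases hk0 : p.coeff k = 0
    · simp [coeff_scaleRoots, hk0]
    rcases lt_or_ge k n with hk | hk
    · rw [hord k hk hk0]
      have h1 := hmin k (Finset.mem_filter.2 ⟨Finset.mem_range.2 hk, hk0⟩)
      have h2 : (0 : ℚ) < (n : ℚ) - k := sub_pos.2 (by exact_mod_cast hk)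
      rw [le_div_iff₀ h2] at h1
      refine WithTop.coe_le_coe.2 (sub_nonneg.2 ?_)
      rwa [mul_comm]
    · have hkn : k = n := le_antisymm (le_natDegree_of_ne_zero hk0) hk
      rw [hkn, hn, coeff_scaleRoots_natDegree, hp.leadingCoeff]
      exact HahnSeries.orderTop_one.ge
  · have h2 : (0 : ℚ) < (n : ℚ) - k₀ := sub_pos.2 (by exact_mod_cast hk₀.1)
    rw [hord k₀ hk₀.1 hk₀.2, hσ, mul_div_cancel₀ _ h2.ne', sub_self]
    rfl

/-- If a depressed monic complex polynomial is not a power of the variable, then neither is any of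
its translates. -/
theorem exists_coeff_taylor_ne_zero {q : ℂ[X]} (hq : q.Monic)
    (h1 : q.coeff (q.natDegree - 1) = 0) (hk : ∃ k < q.natDegree, q.coeff k ≠ 0) (c : ℂ) :
    ∃ k < q.natDegree, (taylor c q).coeff k ≠ 0 := by
  by_contra! hcon
  obtain ⟨k, hkn, hk⟩ := hk
  have ht : taylor c q = X ^ q.natDegree := by
    ext j
    rw [coeff_X_pow]
    rcases lt_trichotomy j q.natDegree with h | h | h
    · rw [if_neg h.ne, hcon j h]
    · rw [if_pos h, h, coeff_taylor_natDegree, hq.leadingCoeff]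
    · rw [if_neg h.ne', coeff_eq_zero_of_natDegree_lt (by rwa [natDegree_taylor])]
  have hq' : q = (X - C c) ^ q.natDegree := by
    have := congrArg (taylor (-c)) ht
    rw [taylor_taylor, neg_add_cancel, taylor_zero, taylor_X_pow, C_neg, ← sub_eq_add_neg] at this
    exact this
  -- The coefficient of `(y - c)^n` in degree `n - 1` is `-n c`.
  have hc : c = 0 := by
    rw [hq', sub_eq_add_neg, ← C_neg, coeff_X_add_C_pow] at h1
    rw [C_neg, ← sub_eq_add_neg, ← hq', Nat.sub_sub_self (by omega), pow_one, mul_eq_zero, neg_eq_zero] at h1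
    refine h1.resolve_right ?_
    exact_mod_cast (Nat.choose_pos (Nat.sub_le _ _)).ne'
  rw [hc, C_0, sub_zero] at hq'
  rw [hq', coeff_X_pow, if_neg hkn.ne] at hk
  exact hk rfl

instance charZero_Puiseux : CharZero Puiseux :=
  charZero_of_injective_ringHom ((ramifyP 1).comp PowerSeries.C).injective

theorem exists_root_of_monic (n : ℕ) : ∀ p : Puiseux[X], p.Monic → p.natDegree = n → n ≠ 0 →
    ∃ a, p.eval a = 0 := by
  induction n using Nat.strong_induction_on with
  | _ n ih =>
  intro p hp hpn hn
  set b := -(p.coeff (p.natDegree - 1) / p.natDegree) with hb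
  suffices h : ∃ a, (taylor b p).eval a = 0 by
    obtain ⟨a, ha⟩ := h
    exact ⟨a + b, by rwa [taylor_eval] at ha⟩
  have h1 := coeff_taylor_tschirnhaus hp (hpn ▸ hn)
  rw [← hb, ← natDegree_taylor p b] at h1
  have hp1 : (taylor b p).Monic := (leadingCoeff_taylor _ _).trans hp
  have hpn1 : (taylor b p).natDegree = n := (natDegree_taylor p b).trans hpn
  generalize taylor b p = P at h1 hp1 hpn1
  by_cases hX : P = X ^ P.natDegree
  · exact ⟨0, by rw [hX, hpn1]; simp [hn]⟩
  obtain ⟨c, hc, hint, k, hk, hk0⟩ := exists_scaleRoots_integral hp1 hX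
  suffices h : ∃ a, (P.scaleRoots c).eval a = 0 by
    obtain ⟨a, ha⟩ := h
    refine ⟨a / c, ?_⟩
    have := scaleRoots_eval_mul P (a / c) c
    rw [mul_div_cancel₀ _ hc, ha] at this
    exact (mul_eq_zero.1 this.symm).resolve_left (pow_ne_zero _ hc)
  have hp2 := (monic_scaleRoots_iff c).2 hp1
  have h2 : (P.scaleRoots c).coeff ((P.scaleRoots c).natDegree - 1) = 0 := by
    rw [natDegree_scaleRoots, coeff_scaleRoots, h1, zero_mul]
  rw [← natDegree_scaleRoots P c] at hk
  rw [← natDegree_scaleRoots P c] at hpn1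
  generalize P.scaleRoots c = R at hint hk hk0 hp2 h2 hpn1
  obtain ⟨d, Q, rfl, hQn, hQ⟩ := exists_map_ramifyP_eq hp2 hint
  rw [← hQn] at hk h2 hpn1
  have hcc : ∀ j, (Q.map PowerSeries.constantCoeff).coeff j =
      ((Q.map (ramifyP d)).coeff j : HahnSeries ℚ ℂ).coeff 0 := fun j => by
    rw [coeff_map, coeff_map, constantCoeff_eq d]
  have hqn : (Q.map PowerSeries.constantCoeff).natDegree = Q.natDegree := hQ.natDegree_map _
  obtain ⟨z, hz⟩ := IsAlgClosed.exists_root (Q.map PowerSeries.constantCoeff) (by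
    rw [degree_eq_natDegree (hQ.map _).ne_zero, hqn, hpn1]
    exact_mod_cast hn)
  have hmap : (taylor (PowerSeries.C z) Q).map PowerSeries.constantCoeff =
      taylor z (Q.map PowerSeries.constantCoeff) := by
    rw [map_taylor]; simp
  -- After translation by a root `z` of the reduction, the reduction vanishes at `0` without being a
  -- power of `y`, so a factor of smaller degree splits off.
  obtain ⟨G, hG, ⟨G', hdvd⟩, hG0, hGn⟩ := exists_proper_monic_dvd
    (Q := taylor (PowerSeries.C z) Q)
    (by rw [hmap, taylor_coeff_zero]; exact hz)
    (by
      rw [hmap, natDegree_taylor, ← hqn]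
      refine exists_coeff_taylor_ne_zero (hQ.map _) ?_ ⟨k, by rwa [hqn], ?_⟩ z
      · rw [hqn, hcc, h2]; rfl
      · rw [hcc]
        exact HahnSeries.coeff_orderTop_ne hk0)
  rw [natDegree_taylor, hpn1] at hGn
  obtain ⟨y, hy⟩ := ih G.natDegree hGn (G.map (ramifyP d)) (hG.map _) (hG.natDegree_map _) hG0.ne'
  refine ⟨y + ramifyP d (PowerSeries.C z), ?_⟩
  rw [← taylor_eval, ← map_taylor, hdvd, Polynomial.map_mul, eval_mul, hy, zero_mul]

/-- **Newton–Puiseux theorem**. -/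
instance isAlgClosed_Puiseux : IsAlgClosed Puiseux :=
  IsAlgClosed.of_exists_root _ fun p hp hirr =>
    exists_root_of_monic p.natDegree p hp rfl hirr.natDegree_pos.ne'

/-! ### Branches as Hahn series, and the factorization of `f` -/

theorem subtype_comp_toPuiseux : Puiseux.subtype.comp toPuiseux = ramify 1 := rfl

/-- The branches of `f` as Hahn series. -/
def hahnBranches (f : ℂ⸨X⸩[X]) : Finset (HahnSeries ℚ ℂ) :=
  (branches f).map ⟨Subtype.val, Subtype.val_injective⟩

theorem mem_hahnBranches {f : ℂ⸨X⸩[X]} {a : HahnSeries ℚ ℂ} :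
    a ∈ hahnBranches f ↔ ∃ b ∈ branches f, (b : HahnSeries ℚ ℂ) = a := by
  simp [hahnBranches]

theorem card_hahnBranches (f : ℂ⸨X⸩[X]) : (hahnBranches f).card = (branches f).card :=
  Finset.card_map _

theorem map_subtype_rootPoly (f : ℂ⸨X⸩[X]) :
    (rootPoly (branches f)).map Puiseux.subtype = rootPoly (hahnBranches f) := by
  simp [rootPoly, Lagrange.nodal, hahnBranches, Polynomial.map_prod]

theorem map_dxL (p : ℂ⸨X⸩[X]) : (dxL p).map (ramify 1) = mapCoeffs hahnD (p.map (ramify 1)) :=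
  map_mapCoeffs (fun a => hahnD_ramify_one a) p

theorem coe_valueAt (p : ℂ⸨X⸩[X]) (a : Puiseux) :
    (valueAt p a : HahnSeries ℚ ℂ) = (p.map (ramify 1)).eval (a : HahnSeries ℚ ℂ) := by
  rw [valueAt, eval_map, ← subtype_comp_toPuiseux]
  exact hom_eval₂ p toPuiseux Puiseux.subtype a

theorem orderTop_pow {a : HahnSeries ℚ ℂ} {t : ℚ} (h : a.orderTop = t) (n : ℕ) :
    (a ^ n).orderTop = ((n * t : ℚ) : WithTop ℚ) := by
  induction n with
  | zero => simp
  | succ n ih =>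
    rw [pow_succ, HahnSeries.orderTop_mul, ih, h, ← WithTop.coe_add]
    congr 1
    push_cast
    ring

/-- The roots of a distinguished polynomial have positive order. -/
theorem orderTop_pos_of_eval_eq_zero {P : (HahnSeries ℚ ℂ)[X]} (hP : P.Monic)
    (hk : ∀ k < P.natDegree, ((1 : ℚ) : WithTop ℚ) ≤ (P.coeff k).orderTop)
    {a : HahnSeries ℚ ℂ} (ha : P.eval a = 0) : 0 < a.orderTop := by
  by_cases ha0 : a = 0
  · simp [ha0]
  obtain ⟨t, ht⟩ := exists_orderTop_eq ha0
  by_contra hneg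
  have ht0 : t ≤ 0 := by
    rw [ht, not_lt] at hneg
    exact_mod_cast hneg
  rw [eval_eq_sum_range, Finset.sum_range_succ, hP.coeff_natDegree, one_mul,
    add_eq_zero_iff_neg_eq] at ha
  -- If `t ≤ 0`, each lower term `P_k a^k` has order at least `1 + k t ≥ 1 + n t`, but their sum is
  -- `-a^n`, of order `n t`.
  have h1 : ((1 + P.natDegree * t : ℚ) : WithTop ℚ) ≤ (a ^ P.natDegree).orderTop := by
    rw [← ha, HahnSeries.orderTop_neg]
    refine le_orderTop_sum fun k hk' => ?_
    rw [Finset.mem_range] at hk'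
    have hkn : (k : ℚ) ≤ P.natDegree := by exact_mod_cast hk'.le
    exact le_orderTop_of_le (by nlinarith) (le_orderTop_mul (hk k hk') (orderTop_pow ht k).ge)
  rw [orderTop_pow ht, WithTop.coe_le_coe] at h1
  linarith

section Separable

/-- Gauss's lemma: a factor over the fraction field is, up to a constant, the image of a monic
polynomial over `A`, and divisibility by its square descends. -/
theorem squarefree_map_of_monic {A K : Type*} [CommRing A] [IsDomain A] [IsIntegrallyClosed A]
    [Field K] [Algebra A K] [IsFractionRing A K] {f : A[X]} (hf : f.Monic) (hsq : Squarefree f) :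
    Squarefree (f.map (algebraMap A K)) := by
  intro g hg
  have hf0 : f.map (algebraMap A K) ≠ 0 := (hf.map _).ne_zero
  have hg0 : g ≠ 0 := fun h => hf0 (by simpa [h] using hg)
  obtain ⟨p, hp⟩ := IsIntegrallyClosed.eq_map_mul_C_of_dvd K hf (dvd_of_mul_left_dvd hg)
  have hlc : g.leadingCoeff ≠ 0 := leadingCoeff_ne_zero.2 hg0
  have hpm : p.Monic := by
    have h1 := congrArg leadingCoeff hp
    rw [leadingCoeff_mul, leadingCoeff_C] at h1
    have h2 : (p.map (algebraMap A K)).leadingCoeff = 1 := mul_right_cancel₀ hlc (by simpa using h1)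
    rw [leadingCoeff_map_of_injective (IsFractionRing.injective A K)] at h2
    exact IsFractionRing.injective A K (by rw [h2, map_one])
  have hdvd : p * p ∣ f := by
    refine (Monic.dvd_iff_fraction_map_dvd_fraction_map (K := K) hf (hpm.mul hpm)).1 ?_
    refine dvd_trans ?_ hg
    rw [Polynomial.map_mul]
    exact mul_dvd_mul ⟨_, hp.symm⟩ ⟨_, hp.symm⟩
  have hu := hsq p hdvd
  rw [← hp]
  exact (hu.map (mapRingHom (algebraMap A K))).mul (isUnit_C.2 (isUnit_iff_ne_zero.2 hlc))

variable {f : ℂ⟦X⟧[X]} (hf : f.IsDistinguishedAt (IsLocalRing.maximalIdeal ℂ⟦X⟧))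
  (hred : Squarefree f)
include hf

theorem toL_monic : (toL f).Monic := hf.monic.map _

theorem natDegree_toL : (toL f).natDegree = f.natDegree := hf.monic.natDegree_map _

theorem orderTop_pos_of_mem {a : HahnSeries ℚ ℂ} (ha : a ∈ hahnBranches (toL f)) :
    0 < a.orderTop := by
  have hn : ((toL f).map (ramify 1)).natDegree = f.natDegree := by
    rw [natDegree_map, natDegree_toL hf]
  refine orderTop_pos_of_eval_eq_zero ((toL_monic hf).map (ramify 1)) (fun k hk => ?_) ?_
  · have hc := hf.mem (hn ▸ hk)
    rw [PowerSeries.maximalIdeal_eq_span_X, Ideal.mem_span_singleton, PowerSeries.X_dvd_iff] at hc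
    have h1 := (orderTop_ramify_one ((toL f).coeff k) (r := 1)).2 (by
      rw [HahnSeries.le_orderTop_iff_forall]
      intro j hj
      have hj' : j < 1 := by exact_mod_cast hj
      rw [toL, coeff_map, LaurentSeries.coe_algebraMap, PowerSeries.coeff_coe]
      split_ifs with h
      · rfl
      · have : j = 0 := by omega
        simpa [this] using hc)
    rw [coeff_map]
    exact_mod_cast h1
  · obtain ⟨b, hb, rfl⟩ := mem_hahnBranches.1 ha
    rw [← coe_valueAt, valueAt, ← eval_map]
    classical
    have h := (mem_roots'.1 (Multiset.mem_toFinset.1 hb)).2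
    rw [h.eq_zero]
    rfl

include hred

theorem map_toPuiseux_toL : (toL f).map toPuiseux = rootPoly (branches (toL f)) := by
  classical
  have : CharZero ℂ⸨X⸩ := charZero_of_injective_algebraMap (algebraMap ℂ ℂ⸨X⸩).injective
  have hsep : ((toL f).map toPuiseux).Separable :=
    (PerfectField.separable_iff_squarefree.2 (squarefree_map_of_monic hf.monic hred)).map
  have hval : (branches (toL f)).val = ((toL f).map toPuiseux).roots := by
    rw [branches, Multiset.toFinset_val, Multiset.dedup_eq_self]
    exact nodup_roots hsep
  have hsplit := (IsAlgClosed.splits ((toL f).map toPuiseux)).eq_prod_roots_of_monic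
    ((toL_monic hf).map _)
  rw [hsplit, ← hval]
  rfl

theorem card_branches : (branches (toL f)).card = f.natDegree := by
  rw [← natDegree_rootPoly, ← map_toPuiseux_toL hf hred, natDegree_map, natDegree_toL hf]

theorem map_ramify_toL : (toL f).map (ramify 1) = rootPoly (hahnBranches (toL f)) := by
  rw [← map_subtype_rootPoly, ← map_toPuiseux_toL hf hred, Polynomial.map_map,
    subtype_comp_toPuiseux]

theorem map_derivative_toL : (derivative (toL f)).map (ramify 1) =
    derivative (rootPoly (hahnBranches (toL f))) := by
  rw [← derivative_map, map_ramify_toL hf hred]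

theorem mem_E_iff {p : ℂ⸨X⸩[X]} {r : ℚ} : p ∈ E (toL f) r ↔ p.degree < f.natDegree ∧
    ∀ a ∈ hahnBranches (toL f),
      (r : WithTop ℚ) ≤ (coord (hahnBranches (toL f)) (p.map (ramify 1)) a).orderTop := by
  have h : ∀ b : Puiseux, ν (valueAt p b / valueAt (derivative (toL f)) b) =
      (coord (hahnBranches (toL f)) (p.map (ramify 1)) (b : HahnSeries ℚ ℂ)).orderTop := by
    intro b
    rw [ν, coord, ← map_derivative_toL hf hred, ← coe_valueAt, ← coe_valueAt]
    rfl
  simp only [E, Set.mem_ofPred_eq, natDegree_toL hf, mem_hahnBranches, h]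
  constructor
  · rintro ⟨h1, h2⟩
    exact ⟨h1, by rintro _ ⟨b, hb, rfl⟩; exact h2 b hb⟩
  · rintro ⟨h1, h2⟩
    exact ⟨h1, fun b hb => h2 _ ⟨b, hb, rfl⟩⟩

end Separable

theorem orderTop_prod {ι : Type*} {t : Finset ι} {g : ι → HahnSeries ℚ ℂ} {q : ι → ℚ}
    (h : ∀ i ∈ t, (g i).orderTop = q i) :
    (∏ i ∈ t, g i).orderTop = ((∑ i ∈ t, q i : ℚ) : WithTop ℚ) := by
  classical
  induction t using Finset.induction_on with
  | empty => exact HahnSeries.orderTop_one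
  | insert i t hi ih =>
    rw [Finset.prod_insert hi, Finset.sum_insert hi, HahnSeries.orderTop_mul,
      h i (Finset.mem_insert_self i t), ih fun j hj => h j (Finset.mem_insert_of_mem hj)]
    rfl

theorem orderTop_coe_eq_interMult {a b : Puiseux} (h : a ≠ b) :
    ((a : HahnSeries ℚ ℂ) - b).orderTop = interMult a b := by
  obtain ⟨t, ht⟩ := exists_orderTop_eq (b := (a : HahnSeries ℚ ℂ) - b)
    (sub_ne_zero.2 fun h' => h (Subtype.ext h'))
  have : interMult a b = t := by
    change WithTop.untopD 0 (((a : HahnSeries ℚ ℂ) - b).orderTop) = t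
    rw [ht]; rfl
  rw [this, ht]

/-- The order of `f'_y` along a branch, and the bound defining `piInv`. -/
theorem exists_orders_le_piInv (f : ℂ⸨X⸩[X]) : ∀ a ∈ hahnBranches f, ∀ b ∈ hahnBranches f, a ≠ b →
    ∃ m t : ℚ, ((derivative (rootPoly (hahnBranches f))).eval a).orderTop = m ∧
      (a - b).orderTop = t ∧ m + t ≤ piInv f := by
  classical
  intro a ha' b hb' hab
  obtain ⟨a, ha, rfl⟩ := mem_hahnBranches.1 ha'
  obtain ⟨b, hb, rfl⟩ := mem_hahnBranches.1 hb'
  have hab' : a ≠ b := fun h => hab (congrArg _ h)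
  refine ⟨totalMult f a, interMult a b, ?_, orderTop_coe_eq_interMult hab', ?_⟩
  · rw [← map_subtype_rootPoly, derivative_map]
    have h1 : (a : HahnSeries ℚ ℂ) = Puiseux.subtype a := rfl
    rw [h1, eval_map_apply]
    rw [eval_derivative_rootPoly ha, map_prod]
    have h2 : (∏ b ∈ (branches f).erase a, Puiseux.subtype (a - b)).orderTop =
        ((∑ b ∈ (branches f).erase a, interMult a b : ℚ) : WithTop ℚ) := orderTop_prod
      fun c hc => orderTop_coe_eq_interMult (Finset.ne_of_mem_erase hc).symm
    rw [h2, totalMult]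
  · have hmem : totalMult f a + interMult a b ∈
        (branches f).offDiag.image (fun p => totalMult f p.1 + interMult p.1 p.2) :=
      Finset.mem_image.2 ⟨(a, b), Finset.mem_offDiag.2 ⟨ha, hb, hab'⟩, rfl⟩
    obtain ⟨y, hy⟩ := Finset.max_of_mem hmem
    have h1 := Finset.le_max hmem
    rw [hy] at h1
    -- The set of pairs is nonempty, so the default of `unbotD` plays no role.
    have h2 : piInv f = y := by
      unfold piInv
      have : ((branches f).offDiag.image
        (fun p => totalMult f p.1 + interMult p.1 p.2)).max = y := hy
      refine Eq.trans ?_ (congrArg (WithBot.unbotD 0) this)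
      congr!
    rw [h2]
    exact WithBot.coe_le_coe.1 h1

/-! ### Existence by dimension count, and integrality -/

/-- If `u f₁ + v f₂` determines `u` and `v` of degree `< k`, then every polynomial of degree
`< 2 k` is of this form. -/
theorem exists_eq_mul_add_mul {K : Type*} [Field K] {k : ℕ} {f₁ f₂ : K[X]}
    (h₁ : f₁.natDegree ≤ k) (h₂ : f₂.natDegree ≤ k)
    (hinj : ∀ u v : K[X], u.degree < k → v.degree < k → u * f₁ + v * f₂ = 0 → u = 0 ∧ v = 0)
    {w : K[X]} (hw : w.degree < (2 * k : ℕ)) :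
    ∃ u v : K[X], u.degree < k ∧ v.degree < k ∧ w = u * f₁ + v * f₂ := by
  have hmul : ∀ {u g : K[X]}, u.degree < k → g.natDegree ≤ k → (u * g).degree < (2 * k : ℕ) := by
    intro u g hu hg
    by_cases hu0 : u = 0
    · rw [hu0, zero_mul, degree_zero]
      exact WithBot.bot_lt_coe _
    · have := (natDegree_lt_iff_degree_lt hu0).2 hu
      refine (degree_le_natDegree).trans_lt ?_
      have := natDegree_mul_le (p := u) (q := g)
      exact_mod_cast (by omega : (u * g).natDegree < 2 * k)
  let T : (degreeLT K k × degreeLT K k) →ₗ[K] degreeLT K (2 * k) :=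
    { toFun := fun p => ⟨p.1 * f₁ + p.2 * f₂, Submodule.add_mem _
        (mem_degreeLT.2 (hmul (mem_degreeLT.1 p.1.2) h₁))
        (mem_degreeLT.2 (hmul (mem_degreeLT.1 p.2.2) h₂))⟩
      map_add' := fun p q => Subtype.ext (by simp; ring)
      map_smul' := fun c p => Subtype.ext (by simp) }
  have : ∀ m, Module.Finite K (degreeLT K m) := fun m =>
    Module.Finite.equiv (degreeLTEquiv K m).symm
  have hfin : ∀ m, Module.finrank K (degreeLT K m) = m := fun m => by
    rw [(degreeLTEquiv K m).finrank_eq, Module.finrank_fin_fun]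
  have hT : Function.Injective T := by
    rw [injective_iff_map_eq_zero]
    rintro ⟨⟨u, hu⟩, ⟨v, hv⟩⟩ h
    have := hinj u v (mem_degreeLT.1 hu) (mem_degreeLT.1 hv) (congrArg Subtype.val h)
    simp [this.1, this.2]
  have hsurj := (LinearMap.injective_iff_surjective_of_finrank_eq_finrank (by
    rw [Module.finrank_prod, hfin, hfin, two_mul])).1 hT
  obtain ⟨⟨⟨u, hu⟩, ⟨v, hv⟩⟩, h⟩ := hsurj ⟨w, mem_degreeLT.2 hw⟩
  exact ⟨u, v, mem_degreeLT.1 hu, mem_degreeLT.1 hv, (congrArg Subtype.val h).symm⟩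

theorem degree_derivative_lt_of_lt {K : Type*} [Semiring K] {p : K[X]} {n : ℕ}
    (hp : p.degree < n) : (derivative p).degree < n :=
  (degree_derivative_le).trans_lt hp

theorem eq_zero_of_forall_le_orderTop {a : HahnSeries ℚ ℂ}
    (h : ∀ r : ℚ, (r : WithTop ℚ) ≤ a.orderTop) : a = 0 := by
  by_contra ha
  obtain ⟨t, ht⟩ := exists_orderTop_eq ha
  have := h (t + 1)
  rw [ht, WithTop.coe_le_coe] at this
  linarith

section Integrality

theorem zero_le_orderTop_coeff_mul {p q : (HahnSeries ℚ ℂ)[X]}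
    (hp : ∀ k, ((0 : ℚ) : WithTop ℚ) ≤ (p.coeff k).orderTop)
    (hq : ∀ k, ((0 : ℚ) : WithTop ℚ) ≤ (q.coeff k).orderTop) (k : ℕ) :
    ((0 : ℚ) : WithTop ℚ) ≤ ((p * q).coeff k).orderTop := by
  rw [coeff_mul]
  exact le_orderTop_sum fun i _ => by simpa using le_orderTop_mul (hp i.1) (hq i.2)

theorem zero_le_orderTop_coeff_rootPoly {s : Finset (HahnSeries ℚ ℂ)}
    (hs : ∀ a ∈ s, 0 ≤ a.orderTop) :
    ∀ k, ((0 : ℚ) : WithTop ℚ) ≤ ((rootPoly s).coeff k).orderTop := by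
  classical
  induction s using Finset.induction_on with
  | empty =>
    intro k
    rw [rootPoly, Lagrange.nodal_empty, coeff_one]
    split_ifs <;> simp
  | insert a t ha ih =>
    rw [rootPoly, Lagrange.nodal_insert_eq_nodal ha]
    refine zero_le_orderTop_coeff_mul (fun k => ?_)
      (ih fun b hb => hs b (Finset.mem_insert_of_mem hb))
    rw [coeff_sub]
    refine le_orderTop_sub ?_ ?_
    · rw [coeff_X]
      split_ifs <;> simp
    · rw [coeff_C]
      split_ifs
      · exact hs a (Finset.mem_insert_self a t)
      · simp

/-- The Lagrange basis polynomials have integral coefficients, since the roots are integral. -/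
theorem zero_le_orderTop_coeff {s : Finset (HahnSeries ℚ ℂ)} (hs : ∀ a ∈ s, 0 ≤ a.orderTop)
    {p : (HahnSeries ℚ ℂ)[X]} (hp : p.degree < s.card)
    (h : ∀ a ∈ s, ((0 : ℚ) : WithTop ℚ) ≤ (coord s p a).orderTop) (k : ℕ) :
    ((0 : ℚ) : WithTop ℚ) ≤ (p.coeff k).orderTop := by
  classical
  rw [eq_sum_lagrange hp, finsetSum_coeff]
  refine le_orderTop_sum fun a ha => ?_
  rw [coeff_C_mul]
  rw [← zero_add (0 : ℚ)]
  exact le_orderTop_mul (h a ha)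
    (zero_le_orderTop_coeff_rootPoly (fun b hb => hs b (Finset.mem_of_mem_erase hb)) k)

theorem exists_toL_eq {p : ℂ⸨X⸩[X]}
    (h : ∀ k, ((0 : ℚ) : WithTop ℚ) ≤ ((p.map (ramify 1)).coeff k).orderTop) :
    ∃ P : ℂ⟦X⟧[X], toL P = p := by
  refine (mem_lifts p).1 ((lifts_iff_coeff_lifts p).2 fun k => ?_)
  have hk := h k
  rw [coeff_map] at hk
  obtain ⟨g, hg⟩ := exists_powerSeries_eq ⟨p.coeff k, rfl⟩ hk
  exact ⟨g, (ramify 1).injective hg⟩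

theorem toL_dxP (p : ℂ⟦X⟧[X]) : toL (dxP p) = dxL (toL p) := by
  refine map_mapCoeffs (fun g => ?_) p
  ext k
  change (LaurentSeries.derivative ℂ (HahnSeries.ofPowerSeries ℤ ℂ g)).coeff k =
    (HahnSeries.ofPowerSeries ℤ ℂ (PowerSeries.derivative ℂ g)).coeff k
  rw [LaurentSeries.derivative_apply, LaurentSeries.hasseDeriv_coeff, PowerSeries.coeff_coe,
    PowerSeries.coeff_coe]
  by_cases hk : k < 0
  -- At `k = -1` it is the factor `k + 1` that vanishes.
  · by_cases hk1 : k = -1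
    · simp [hk1]
    · have : k + 1 < 0 := by omega
      simp [hk, this]
  · obtain ⟨n, rfl⟩ := Int.eq_ofNat_of_zero_le (not_lt.1 hk)
    have h1 : ¬ ((n : ℤ) + 1 < 0) := by omega
    have h2 : ((n : ℤ) + 1).natAbs = n + 1 := by omega
    rw [Nat.cast_one, if_neg h1, if_neg hk, h2]
    simp [PowerSeries.coeff_derivative, mul_comm]

end Integrality

/-! ### The theorem for distinguished squarefree `f` -/

section Main

variable {f : ℂ⟦X⟧[X]} (hf : f.IsDistinguishedAt (IsLocalRing.maximalIdeal ℂ⟦X⟧))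
  (hred : Squarefree f) (hn : 2 ≤ f.natDegree)
include hf hred

theorem card_hahnBranches_toL : (hahnBranches (toL f)).card = f.natDegree := by
  rw [card_hahnBranches, card_branches hf hred]

theorem map_ramify_jacobian (u v : ℂ⸨X⸩[X]) :
    (u * dxL (toL f) + v * derivative (toL f)).map (ramify 1) =
      u.map (ramify 1) * mapCoeffs hahnD (rootPoly (hahnBranches (toL f))) +
        v.map (ramify 1) * derivative (rootPoly (hahnBranches (toL f))) := by
  rw [Polynomial.map_add, Polynomial.map_mul, Polynomial.map_mul, map_dxL,
    map_derivative_toL hf hred, map_ramify_toL hf hred]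

theorem mem_F_iff {p : ℂ⸨X⸩[X]} {r : ℚ} : p ∈ F (toL f) r ↔
    p.degree < (f.natDegree - 1 : ℕ) ∧ ∀ a ∈ hahnBranches (toL f),
      (r : WithTop ℚ) ≤ (coord (hahnBranches (toL f)) (p.map (ramify 1)) a).orderTop := by
  rw [F, Set.mem_ofPred_eq, mem_E_iff hf hred, natDegree_toL hf]
  constructor
  · exact fun h => ⟨h.2, h.1.2⟩
  · exact fun h => ⟨⟨h.1.trans_le (by exact_mod_cast Nat.sub_le _ _), h.2⟩, h.1⟩

theorem natDegree_partial_le :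
    (dxL (toL f)).natDegree ≤ f.natDegree - 1 ∧
      (derivative (toL f)).natDegree ≤ f.natDegree - 1 := by
  constructor
  · have h1 := degree_mapCoeffs_lt hahnD_mul (rootPoly_monic (s := hahnBranches (toL f)))
    rw [← map_ramify_toL hf hred, ← map_dxL, degree_map, natDegree_map, natDegree_toL hf] at h1
    rcases Nat.eq_zero_or_pos (dxL (toL f)).natDegree with h0 | h0
    · omega
    · have := (natDegree_lt_iff_degree_lt (ne_zero_of_natDegree_gt h0)).2 h1
      omega
  · rw [← natDegree_toL hf]
    exact natDegree_derivative_le _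

include hn

theorem deltaInv_spec : 0 ≤ deltaInv (toL f) ∧ ∀ a ∈ hahnBranches (toL f),
    (deltaInv (toL f) : WithTop ℚ) ≤ a.orderTop := by
  have hcard := card_branches hf hred
  obtain ⟨a, ha, ha0⟩ := Finset.exists_mem_ne (s := branches (toL f)) (by omega) 0
  have hle : (branches (toL f)).inf ν ≤ ν a := Finset.inf_le ha
  have hpos : 0 ≤ (branches (toL f)).inf ν := Finset.le_inf fun b hb =>
    (orderTop_pos_of_mem hf (mem_hahnBranches.2 ⟨b, hb, rfl⟩)).le
  -- As `n ≥ 2`, some root is nonzero, so the infimum is finite and `untopD` returns it.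
  have hne : (branches (toL f)).inf ν ≠ ⊤ := by
    intro h
    rw [h, top_le_iff] at hle
    exact ha0 (Subtype.ext (HahnSeries.orderTop_eq_top.1 hle))
  obtain ⟨t, ht⟩ := WithTop.ne_top_iff_exists.1 hne
  have hδ : deltaInv (toL f) = t := by
    rw [deltaInv, ← ht]; rfl
  rw [hδ]
  refine ⟨by rw [← ht] at hpos; exact_mod_cast hpos, fun a ha => ?_⟩
  obtain ⟨b, hb, rfl⟩ := mem_hahnBranches.1 ha
  rw [ht]
  exact Finset.inf_le hb

/-- The bounds for the representation `w = u f_x + v f_y` when it exists. -/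
theorem mem_F_of_eq {u v w : ℂ⸨X⸩[X]} {r : ℚ} (hu : u.degree < (f.natDegree - 1 : ℕ))
    (hv : v.degree < (f.natDegree - 1 : ℕ)) (hw : w ∈ E (toL f) r)
    (h : w = u * dxL (toL f) + v * derivative (toL f)) :
    u ∈ F (toL f) (r - thetaInv (toL f)) ∧ v ∈ F (toL f) (r - tauInv (toL f)) := by
  have hcard := card_hahnBranches_toL hf hred
  obtain ⟨hwd, hr⟩ := (mem_E_iff hf hred).1 hw
  have h' := congrArg (Polynomial.map (ramify 1)) h
  rw [map_ramify_jacobian hf hred] at h'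
  have hu' := le_orderTop_coord_left (exists_orders_le_piInv (toL f))
    (w := w.map (ramify 1)) (by rwa [degree_map, hcard]) (by rwa [degree_map, hcard])
    (by rwa [degree_map, hcard]) (fun a ha => orderTop_pos_of_mem hf ha) h' hr
  have hv' := le_orderTop_coord_right (exists_orders_le_piInv (toL f)) (by omega)
    (deltaInv_spec hf hred hn).2 h' hr hu'
  exact ⟨(mem_F_iff hf hred).2 ⟨hu, hu'⟩, (mem_F_iff hf hred).2 ⟨hv, hv'⟩⟩

/-- The zero polynomial lies in every `E_r`, so the bounds force the coordinates of `u` to have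
arbitrarily large order. -/
theorem eq_zero_of_jacobian_eq_zero {u v : ℂ⸨X⸩[X]} (hu : u.degree < (f.natDegree - 1 : ℕ))
    (hv : v.degree < (f.natDegree - 1 : ℕ))
    (h : u * dxL (toL f) + v * derivative (toL f) = 0) : u = 0 ∧ v = 0 := by
  have hcard := card_hahnBranches_toL hf hred
  have key : ∀ r, u ∈ F (toL f) r := fun r => by
    have h0 : (0 : ℂ⸨X⸩[X]) ∈ E (toL f) (r + thetaInv (toL f)) :=
      (mem_E_iff hf hred).2 ⟨by simp [bot_lt_iff_ne_bot], fun a _ => by simp [coord]⟩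
    simpa using (mem_F_of_eq hf hred hn hu hv h0 h.symm).1
  have hu0 : u = 0 := by
    refine (Polynomial.map_eq_zero (ramify 1)).1
      (eq_zero_of_degree_lt_of_eval_finset_eq_zero (hahnBranches (toL f)) ?_ fun a ha => ?_)
    · rw [degree_map, hcard]
      exact hu.trans_le (by exact_mod_cast Nat.sub_le _ _)
    · have := eq_zero_of_forall_le_orderTop fun r => ((mem_F_iff hf hred).1 (key r)).2 a ha
      classical
      exact (div_eq_zero_iff.1 this).resolve_right (eval_derivative_rootPoly_ne_zero ha)
  refine ⟨hu0, ?_⟩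
  rw [hu0, zero_mul, zero_add, mul_eq_zero] at h
  refine h.resolve_right fun hd => ?_
  have h1 : (derivative (rootPoly (hahnBranches (toL f)))) = 0 := by
    rw [← map_derivative_toL hf hred, hd, Polynomial.map_zero]
  obtain ⟨a, ha⟩ := Finset.card_pos.1 (by omega : 0 < (hahnBranches (toL f)).card)
  classical
  exact eval_derivative_rootPoly_ne_zero ha (by rw [h1, eval_zero])

theorem exists_mem_F_eq {w : ℂ⸨X⸩[X]} {r : ℚ} (hw : w ∈ E (toL f) r) :
    ∃ u ∈ F (toL f) (r - thetaInv (toL f)), ∃ v ∈ F (toL f) (r - tauInv (toL f)),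
      w = u * dxL (toL f) + v * derivative (toL f) := by
  obtain ⟨h1, h2⟩ := natDegree_partial_le hf hred
  -- The degree condition amounts to `n ≤ 2 (n - 1)`.
  obtain ⟨u, v, hu, hv, h⟩ := exists_eq_mul_add_mul h1 h2
    (fun u v hu hv h => eq_zero_of_jacobian_eq_zero hf hred hn hu hv h) (w := w)
    (((mem_E_iff hf hred).1 hw).1.trans_le (by exact_mod_cast (by omega)))
  obtain ⟨hu', hv'⟩ := mem_F_of_eq hf hred hn hu hv hw h
  exact ⟨u, hu', v, hv', h⟩

omit hn in
theorem exists_toL_eq_of_mem_F {p : ℂ⸨X⸩[X]} {r : ℚ} (hr : 0 ≤ r) (hp : p ∈ F (toL f) r) :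
    ∃ P : ℂ⟦X⟧[X], toL P = p := by
  obtain ⟨hd, h⟩ := (mem_F_iff hf hred).1 hp
  refine exists_toL_eq (zero_le_orderTop_coeff
    (fun a ha => (orderTop_pos_of_mem hf ha).le) ?_
    fun a ha => le_orderTop_of_le hr (h a ha))
  rw [degree_map, card_hahnBranches_toL hf hred]
  exact hd.trans_le (by exact_mod_cast Nat.sub_le _ _)

/-- For `r = π` the indices are `π - θ = 1` and `π - τ = δ ≥ 0`, so `u` and `v` have power series
coefficients. -/
theorem exists_mem_jacobianIdeal {w : ℂ⸨X⸩[X]} (hw : w ∈ E (toL f) (piInv (toL f))) :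
    ∃ g ∈ jacobianIdeal f, toL g = w := by
  obtain ⟨u, hu, v, hv, rfl⟩ := exists_mem_F_eq hf hred hn hw
  obtain ⟨U, rfl⟩ := exists_toL_eq_of_mem_F hf hred (by simp [thetaInv]) hu
  obtain ⟨V, rfl⟩ := exists_toL_eq_of_mem_F hf hred
    (by simpa [tauInv] using (deltaInv_spec hf hred hn).1) hv
  refine ⟨U * dxP f + V * derivative f, Ideal.add_mem _
    (Ideal.mul_mem_left _ _ (Ideal.subset_span (by simp)))
    (Ideal.mul_mem_left _ _ (Ideal.subset_span (by simp))), ?_⟩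
  rw [← toL_dxP]
  simp [toL, derivative_map]

omit hn in
theorem divergence_mem_F {u v : ℂ⸨X⸩[X]} (hu : u ∈ F (toL f) 1)
    (hv : v.degree < (f.natDegree - 1 : ℕ))
    (hw : u * dxL (toL f) + v * derivative (toL f) ∈ E (toL f) (piInv (toL f))) :
    dxL u + derivative v ∈ F (toL f) 0 := by
  have hcard := card_hahnBranches_toL hf hred
  obtain ⟨hud, hu'⟩ := (mem_F_iff hf hred).1 hu
  obtain ⟨hwd, hr⟩ := (mem_E_iff hf hred).1 hw
  refine (mem_F_iff hf hred).2 ⟨(degree_add_le _ _).trans_lt (max_lt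
    ((degree_mapCoeffs_le _ _).trans_lt hud) (degree_derivative_lt_of_lt hv)), ?_⟩
  -- With `r = ϖ = π`, the order required of `u` is `π - π + 1 = 1`.
  have h := le_orderTop_divergence (exists_orders_le_piInv (toL f))
    (by rwa [degree_map, hcard]) (map_ramify_jacobian hf hred u v) hr
    (fun a ha => le_orderTop_of_le (by linarith) (hu' a ha))
  rw [sub_self] at h
  rwa [Polynomial.map_add, map_dxL, ← derivative_map]

end Main

end PlaneCurve

end

theorem mainTheorem6 (f : ℂ⟦X⟧[X])
    (hf : f.IsDistinguishedAt (IsLocalRing.maximalIdeal ℂ⟦X⟧))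
    (hred : Squarefree f) (hn : 2 ≤ f.natDegree) :
    (∀ r : ℚ, ∀ w ∈ PlaneCurve.E (PlaneCurve.toL f) r,
      ∃ u ∈ PlaneCurve.F (PlaneCurve.toL f) (r - PlaneCurve.thetaInv (PlaneCurve.toL f)),
      ∃ v ∈ PlaneCurve.F (PlaneCurve.toL f) (r - PlaneCurve.tauInv (PlaneCurve.toL f)),
        w = u * PlaneCurve.dxL (PlaneCurve.toL f) + v * derivative (PlaneCurve.toL f)) ∧
    (∀ w ∈ PlaneCurve.E (PlaneCurve.toL f) (PlaneCurve.piInv (PlaneCurve.toL f)),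
      ∃ g ∈ PlaneCurve.jacobianIdeal f, PlaneCurve.toL g = w) ∧
    (∀ u ∈ PlaneCurve.F (PlaneCurve.toL f) 1,
      ∀ v ∈ PlaneCurve.F (PlaneCurve.toL f) (PlaneCurve.deltaInv (PlaneCurve.toL f)),
        u * PlaneCurve.dxL (PlaneCurve.toL f) + v * derivative (PlaneCurve.toL f) ∈
            PlaneCurve.E (PlaneCurve.toL f) (PlaneCurve.piInv (PlaneCurve.toL f)) →
          PlaneCurve.dxL u + derivative v ∈ PlaneCurve.F (PlaneCurve.toL f) 0) := by
  refine ⟨fun r w hw => PlaneCurve.exists_mem_F_eq hf hred hn hw,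
    fun w hw => PlaneCurve.exists_mem_jacobianIdeal hf hred hn hw, fun u hu v hv hw => ?_⟩
  exact PlaneCurve.divergence_mem_F hf hred hu ((PlaneCurve.mem_F_iff hf hred).1 hv).1 hw
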